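/- Let $\mathbb F_q$ be a finite field with $q\equiv 1 \pmod{24}$. Multiplicative characters $\mathbb F_q^\times\to\mathbb C^\times$ are extended to $\mathbb F_q$ by the value $0$ at $0$ (also for the trivial character), $\overline A$ denotes the complex conjugate of $A$, and $\phi$ is the quadratic character. For characters $A,B$ let $J(A,B)=\sum_{y\in\mathbb F_q}A(y)B(1-y)$ be the Jacobi sum, and for characters $A_1,A_2,B_1$ and $\lambda\in\mathbb F_q$ put $${}_2\mathbb F_1\left[\begin{matrix}A_1&A_2\\&B_1\end{matrix};\lambda\right]:=\frac{1}{J(A_2,B_1\overline{A_2})}\sum_{y\in\mathbb F_q}A_2(y)\,\overline{A_2}B_1(1-y)\,\overline{A_1}(1-\lambda y).$$ Let $\eta$ be a character of order $24$ on $\mathbb F_q^\times$ and let $x\in\mathbb F_q$ with $x\neq-\frac18,\frac14$. Then $${}_2\mathbb F_1\left[\begin{matrix}\overline\eta&\eta^7\\&\eta^{18}\end{matrix};\frac{-27x}{(1-4x)^3}\right]=\left(\frac{1+\phi(1-x)}2\right)\left(\eta^3\left(\frac{(1+\sqrt{1-x})^2}{4(1-4x)}\right)+\eta^3\left(\frac{(1-\sqrt{1-x})^2}{4(1-4x)}\right)\right),$$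 where $\sqrt{1-x}$ is either square root of $1-x$ in $\mathbb F_q$ if $1-x$ is a square in $\mathbb F_q$; if $1-x$ is not a square, the factor $\frac{1+\phi(1-x)}2$ is $0$ and the right-hand side is read as $0$. -/

import Mathlib

/-- The period function
`₂ℙ₁[A₁, A₂; B₁; lam] = ∑_{y ∈ F} A₂(y) * (A₂⁻¹ B₁)(1 - y) * A₁⁻¹(1 - lam y)`
of a finite field `F`. Multiplicative characters vanish at `0` (the trivial one included), and
`A⁻¹` is the complex conjugate of the character `A`. -/
noncomputable def FFHyp.period21 {F : Type*} [Field F] [Fintype F]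
    (A₁ A₂ B₁ : MulChar F ℂ) (lam : F) : ℂ :=
  ∑ y : F, A₂ y * (A₂⁻¹ * B₁) (1 - y) * A₁⁻¹ (1 - lam * y)

/-- The normalized hypergeometric function over the finite field `F`,
`₂𝔽₁[A₁, A₂; B₁; lam] = ₂ℙ₁[A₁, A₂; B₁; lam] / J(A₂, B₁ A₂⁻¹)`, where
`J(A, B) = ∑_{y ∈ F} A(y) B(1 - y)` is the Jacobi sum. -/
noncomputable def FFHyp.hyp21 {F : Type*} [Field F] [Fintype F]
    (A₁ A₂ B₁ : MulChar F ℂ) (lam : F) : ℂ :=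
  1 / jacobiSum A₂ (B₁ * A₂⁻¹) * FFHyp.period21 A₁ A₂ B₁ lam

/-- The quadratic character `φ` of `F`, with complex values (`φ(0) = 0`). -/
noncomputable def FFHyp.phi (F : Type*) [Field F] [Fintype F] [DecidableEq F] : MulChar F ℂ :=
  (quadraticChar F).ringHomComp (Int.castRingHom ℂ)

/-! Write q for the cardinality of `F` and G(χ) for Gauss sums. A function on `F` is determined away
from 0 by its Mellin transform χ ↦ Σ χ(M) f(M). Identities between character sums thus become
identities between Gauss sums, which follow from reflection and the Hasse–Davenport formulas for 2
and 3.

With λ = −27θ, the transform of the period in θ contains G(η⁸β)G(η¹⁶β), where β = η¹⁵χ⁻¹.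
Triplication turns this into G(β⁻¹)G(β³), its factor β(−27) being absorbed by the −27 in λ; the
result is the transform of a three-dimensional exponential sum (`period21_eq_exponentialSum`). At θ
= x/(1 − 4x)³ that sum collapses, by homogeneity, to a quadratic character sum over a surface with
parameter M = −8x (`exponentialSum_eq`). Its fibres are conic sums. Parametrizing the conic and then
applying a Möbius change of variable gives `factoredSum`, in which M enters linearly
(`surfaceSum_eq`). The transform of `factoredSum` is, by duplication, essentially that of a sum over
the roots of −32u(1 − u) = M (`factoredSum_eq`). These roots are u = (1 ± √(1 − x))/2, whence the
right-hand side.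

The exceptional characters in the first and last comparison leave one correction term each. The two
cancel in `hyp21_eq_sum`, and `gaussSum_relation` identifies the remaining constant. The point x =
0, invisible to Mellin inversion, is checked directly. -/

namespace FFHyp

/-! ### Mellin inversion over a finite field. -/

section Mellin

variable {F : Type*} [Field F] [Fintype F]

/-- Orthogonality: the characters of `F` sum to zero at every element other than `1`. -/
theorem sum_mulChar_eq_zero [Fintype (MulChar F ℂ)] {a : F} (ha : a ≠ 1) :
    ∑ χ : MulChar F ℂ, χ a = 0 := by
  obtain ⟨χ₀, hχ₀⟩ := MulChar.exists_apply_ne_one_of_hasEnoughRootsOfUnity F ℂ ha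
  have h : χ₀ a * ∑ χ : MulChar F ℂ, χ a = ∑ χ : MulChar F ℂ, χ a := by
    rw [Finset.mul_sum]
    exact Fintype.sum_bijective (χ₀ * ·) (Group.mulLeft_bijective χ₀) _ _
      fun χ => (MulChar.mul_apply χ₀ χ a).symm
  have h' : (χ₀ a - 1) * ∑ χ : MulChar F ℂ, χ a = 0 := by rw [sub_mul, h]; ring
  exact (mul_eq_zero.mp h').resolve_left (sub_ne_zero.mpr hχ₀)

/-- A function on `F` is determined away from `0` by its Mellin transform. -/
theorem eq_of_forall_mellin_eq {f g : F → ℂ}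
    (h : ∀ χ : MulChar F ℂ, ∑ M : F, χ M * f M = ∑ M : F, χ M * g M) {M : F} (hM : M ≠ 0) :
    f M = g M := by
  classical
  have : Fintype (MulChar F ℂ) := Fintype.ofFinite _
  have key : ∀ k : F → ℂ, ∑ χ : MulChar F ℂ, χ M⁻¹ * ∑ N : F, χ N * k N =
      Fintype.card (MulChar F ℂ) * k M := by
    intro k
    simp_rw [Finset.mul_sum]
    rw [Finset.sum_comm]
    have : ∀ N : F, ∑ χ : MulChar F ℂ, χ M⁻¹ * (χ N * k N) =
        (∑ χ : MulChar F ℂ, χ (M⁻¹ * N)) * k N := by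
      intro N
      rw [Finset.sum_mul]
      exact Finset.sum_congr rfl fun χ _ => by rw [map_mul, mul_assoc]
    simp_rw [this]
    rw [Finset.sum_eq_single M]
    · simp [inv_mul_cancel₀ hM]
    · intro N _ hN
      rw [sum_mulChar_eq_zero, zero_mul]
      intro h1
      exact hN (by rw [inv_mul_eq_one₀ hM] at h1; exact h1.symm)
    · simp
  have h0 : (Fintype.card (MulChar F ℂ) : ℂ) ≠ 0 := by
    exact_mod_cast Fintype.card_ne_zero
  have := (key f).symm.trans ((Finset.sum_congr rfl fun χ _ => by rw [h χ]).trans (key g))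
  exact mul_left_cancel₀ h0 this

end Mellin

/-! ### Gauss and Jacobi sums: reflection and uniform formulas. -/

section General

variable {F : Type*} [Field F]

theorem ringChar_ne_two (h2 : (2 : F) ≠ 0) : ringChar F ≠ 2 := fun h => by
  apply h2
  have := ringChar.Nat.cast_ringChar (R := F)
  rw [h] at this
  exact_mod_cast this

theorem apply_neg_one_sq (χ : MulChar F ℂ) : χ (-1) * χ (-1) = 1 := by
  rw [← map_mul]; simp

theorem inv_apply_neg_one (χ : MulChar F ℂ) : χ⁻¹ (-1) = χ (-1) := by
  rw [MulChar.inv_apply']; norm_num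

variable [Fintype F]

theorem card_ne_zero_complex : (Fintype.card F : ℂ) ≠ 0 := by
  exact_mod_cast Fintype.card_ne_zero

theorem gaussSum_one {ψ : AddChar F ℂ} (hψ : ψ.IsPrimitive) :
    gaussSum (1 : MulChar F ℂ) ψ = -1 := by
  refine gaussSum_one_left fun h => ?_
  have := hψ one_ne_zero
  rw [h] at this
  exact this (by ext x; simp)

theorem gaussSum_mul_gaussSum_inv {χ : MulChar F ℂ} (hχ : χ ≠ 1) {ψ : AddChar F ℂ}
    (hψ : ψ.IsPrimitive) :
    gaussSum χ ψ * gaussSum χ⁻¹ ψ = χ (-1) * Fintype.card F := by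
  have h1 := gaussSum_mul_gaussSum_eq_card hχ hψ
  have h2 := mul_gaussSum_inv_eq_gaussSum χ⁻¹ ψ
  rw [inv_apply_neg_one] at h2
  rw [← h2, ← h1]; ring

theorem gaussSum_ne_zero (χ : MulChar F ℂ) {ψ : AddChar F ℂ} (hψ : ψ.IsPrimitive) :
    gaussSum χ ψ ≠ 0 := by
  rcases eq_or_ne χ 1 with rfl | hχ
  · rw [gaussSum_one hψ]; norm_num
  · exact gaussSum_ne_zero_of_nontrivial card_ne_zero_complex hχ hψ

/-- The Jacobi sum as a product of three Gauss sums, uniformly in all pairs of characters other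
than the pair of trivial ones. -/
theorem card_mul_jacobiSum {A B : MulChar F ℂ} (h : ¬(A = 1 ∧ B = 1)) {ψ : AddChar F ℂ}
    (hψ : ψ.IsPrimitive) :
    Fintype.card F * jacobiSum A B =
      A (-1) * B (-1) * (gaussSum A ψ * gaussSum B ψ * gaussSum (A * B)⁻¹ ψ) := by
  by_cases hAB : A * B = 1
  · have hA : A ≠ 1 := fun hA => h ⟨hA, by rwa [hA, one_mul] at hAB⟩
    have hB : B = A⁻¹ := eq_inv_of_mul_eq_one_right hAB
    rw [hAB, inv_one, gaussSum_one hψ, hB, jacobiSum_nontrivial_inv hA,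
      gaussSum_mul_gaussSum_inv hA hψ, inv_apply_neg_one]
    linear_combination (Fintype.card F * A (-1)) * apply_neg_one_sq A
  · have h1 := jacobiSum_mul_nontrivial hAB ψ
    have h2 := gaussSum_mul_gaussSum_inv hAB hψ
    rw [MulChar.mul_apply] at h2
    rw [← h1]
    linear_combination (-(A (-1) * B (-1)) * jacobiSum A B) * h2 -
      (Fintype.card F * jacobiSum A B) * (B (-1) * B (-1)) * apply_neg_one_sq A -
      (Fintype.card F * jacobiSum A B) * apply_neg_one_sq B

/-- Reparametrizing a sum by an invertible affine map. -/
theorem sum_comp_affine {b : F} (hb : b ≠ 0) (a : F) (f : F → ℂ) :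
    ∑ x : F, f (a + b * x) = ∑ x : F, f x :=
  Fintype.sum_bijective (fun x => a + b * x)
    (Finite.injective_iff_bijective.mp fun _ _ hxy => mul_left_cancel₀ hb (add_left_cancel hxy))
    _ _ fun _ => rfl

end General

/-! ### The quadratic character and Hasse–Davenport duplication. -/

section Gauss

variable {F : Type*} [Field F] [Fintype F] [DecidableEq F]

theorem phi_one_of_square {a : F} (ha : a ≠ 0) : phi F (a ^ 2) = 1 := by
  simp [phi, MulChar.ringHomComp_apply, quadraticChar_sq_one' ha]

theorem phi_sq {a : F} (ha : a ≠ 0) : phi F a * phi F a = 1 := by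
  rw [← map_mul, ← sq, phi_one_of_square ha]

theorem card_sqrt_eq (h2 : (2 : F) ≠ 0) (a : F) :
    ((Finset.univ.filter fun s : F => s ^ 2 = a).card : ℂ) = 1 + phi F a := by
  have := quadraticChar_card_sqrts (ringChar_ne_two h2) a
  have h' : (({x : F | x ^ 2 = a}.toFinset.card : ℤ) : ℂ) = (quadraticChar F a + 1 : ℤ) := by
    exact_mod_cast congrArg (Int.cast : ℤ → ℂ) this
  have e : {x : F | x ^ 2 = a}.toFinset = Finset.univ.filter fun s : F => s ^ 2 = a := by
    ext; simp
  rw [e] at h'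
  simp only [phi, MulChar.ringHomComp_apply, eq_intCast]
  push_cast at h'
  rw [h']; ring

/-- Summing over square roots. -/
theorem sum_comp_sq (h2 : (2 : F) ≠ 0) (f : F → ℂ) :
    ∑ s : F, f (s ^ 2) = ∑ a : F, (1 + phi F a) * f a := by
  rw [← Finset.sum_fiberwise Finset.univ (fun s : F => s ^ 2) fun s => f (s ^ 2)]
  refine Finset.sum_congr rfl fun a _ => ?_
  rw [Finset.sum_congr rfl (g := fun _ => f a) fun s hs => by
    rw [(Finset.mem_filter.mp hs).2], Finset.sum_const, nsmul_eq_mul, card_sqrt_eq h2]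

theorem phi_ne_one (h2 : (2 : F) ≠ 0) : phi F ≠ 1 := by
  rw [phi, MulChar.ringHomComp_ne_one_iff (Int.cast_injective (α := ℂ))]
  exact quadraticChar_ne_one (ringChar_ne_two h2)

theorem phi_mul_phi : phi F * phi F = 1 := by
  ext a; rw [MulChar.mul_apply, phi_sq a.ne_zero, MulChar.one_apply_coe]

/-- Substituting y = (1 + s)/2 gives 4y(1 − y) = 1 − s², and summing over s weights a = s² by 1 +
φ(a). -/
theorem four_mul_jacobiSum_self (h2 : (2 : F) ≠ 0) {A : MulChar F ℂ} (hA : A ≠ 1) :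
    A 4 * jacobiSum A A = jacobiSum A (phi F) := by
  have h4 : (2⁻¹ : F) ≠ 0 := inv_ne_zero h2
  rw [jacobiSum, ← sum_comp_affine h4 2⁻¹, Finset.mul_sum]
  have : ∀ s : F, A 4 * (A (2⁻¹ + 2⁻¹ * s) * A (1 - (2⁻¹ + 2⁻¹ * s))) = A (1 - s ^ 2) := by
    intro s
    rw [← map_mul, ← map_mul]; congr 1; field_simp; ring
  simp_rw [this]
  rw [sum_comp_sq h2 fun a => A (1 - a), jacobiSum_comm, jacobiSum]
  simp_rw [add_mul, one_mul]
  rw [Finset.sum_add_distrib]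
  have h0 : ∑ x : F, A (1 - x) = 0 := by
    have := sum_comp_affine (F := F) (b := -1) (by simp) 1 A
    simp only [neg_mul, one_mul, ← sub_eq_add_neg] at this
    rw [this, MulChar.sum_eq_zero_of_ne_one hA]
  rw [h0, zero_add]

theorem eq_phi_of_mul_self_eq_one {A : MulChar F ℂ} (hAA : A * A = 1) (hA : A ≠ 1) :
    A = phi F := by
  ext a
  by_cases hs : IsSquare (a : F)
  · obtain ⟨b, hb⟩ := hs
    have hb0 : b ≠ 0 := by rintro rfl; exact a.ne_zero (by simp at hb)
    rw [hb, map_mul, map_mul, phi_sq hb0, ← MulChar.mul_apply, hAA,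
      MulChar.one_apply (isUnit_iff_ne_zero.mpr hb0)]
  · obtain ⟨c, hc⟩ := MulChar.ne_one_iff.mp hA
    have hcs : ¬ IsSquare (c : F) := by
      rintro ⟨b, hb⟩
      have hb0 : b ≠ 0 := by rintro rfl; exact c.ne_zero (by simp at hb)
      exact hc (by rw [hb, map_mul, ← MulChar.mul_apply, hAA,
        MulChar.one_apply (isUnit_iff_ne_zero.mpr hb0)])
    have hval : ∀ d : F, ¬ IsSquare d → phi F d = -1 := by
      intro d hd
      simp [phi, MulChar.ringHomComp_apply, quadraticChar_neg_one_iff_not_isSquare.mpr hd]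
    have hAc : A c = -1 := by
      have : A c * A c = 1 := by
        rw [← MulChar.mul_apply, hAA, MulChar.one_apply_coe]
      exact (mul_self_eq_one_iff.mp this).resolve_left hc
    have hac : IsSquare ((a : F) * c) := by
      have h1 : phi F ((a : F) * c) = 1 := by rw [map_mul, hval _ hs, hval _ hcs]; norm_num
      by_contra hn
      rw [hval _ hn] at h1; norm_num at h1
    obtain ⟨b, hb⟩ := hac
    have hb0 : b ≠ 0 := by
      rintro rfl
      simp at hb
    have h1 : A ((a : F) * c) = 1 := by
      rw [hb, map_mul, ← MulChar.mul_apply, hAA,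
        MulChar.one_apply (isUnit_iff_ne_zero.mpr hb0)]
    rw [map_mul, hAc] at h1
    rw [hval _ hs]; linear_combination -h1

/-- The Hasse–Davenport duplication formula. -/
theorem gaussSum_duplication (h2 : (2 : F) ≠ 0) (A : MulChar F ℂ) {ψ : AddChar F ℂ}
    (hψ : ψ.IsPrimitive) :
    A 4 * (gaussSum A ψ * gaussSum (A * phi F) ψ) =
      gaussSum (A * A) ψ * gaussSum (phi F) ψ := by
  have h4 : (4 : F) = 2 ^ 2 := by norm_num
  have hsq : A 4 = A 2 * A 2 := by rw [h4, map_pow, sq]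
  -- For A ∈ {1, φ} the identity is trivial; otherwise J(A, A) and J(A, φ) both have Gauss sum
  -- quotients and can be compared.
  by_cases hAA : A * A = 1
  · have hA4 : A 4 = 1 := by
      rw [hsq, ← MulChar.mul_apply, hAA, MulChar.one_apply (isUnit_iff_ne_zero.mpr h2)]
    rw [hA4, hAA, one_mul]
    by_cases hA : A = 1
    · rw [hA, one_mul]
    · rw [eq_phi_of_mul_self_eq_one hAA hA, phi_mul_phi, mul_comm]
  · have hA : A ≠ 1 := fun h => hAA (by rw [h, one_mul])
    have hAφ : A * phi F ≠ 1 := fun h => hAA (by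
      have : A = phi F := by
        have := eq_inv_of_mul_eq_one_left h
        rw [this, inv_eq_iff_mul_eq_one, phi_mul_phi]
      rw [this, phi_mul_phi])
    have h1 := jacobiSum_mul_nontrivial hAA ψ
    have h3 := jacobiSum_mul_nontrivial hAφ ψ
    rw [← four_mul_jacobiSum_self h2 hA] at h3
    have h0 := gaussSum_ne_zero A hψ
    apply mul_left_cancel₀ h0
    linear_combination gaussSum (A * A) ψ * h3 - A 4 * gaussSum (A * phi F) ψ * h1

end Gauss

/-! ### Cardano's formula and Hasse–Davenport triplication. -/

section Cubic

variable {F : Type*} [Field F] [Fintype F] [DecidableEq F]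

theorem phi_neg_one_iff {a : F} : phi F a = -1 ↔ ¬ IsSquare a := by
  rw [← quadraticChar_neg_one_iff_not_isSquare, phi, MulChar.ringHomComp_apply, eq_intCast]
  exact_mod_cast Iff.rfl

/-- The solutions u of u + u⁻¹ = x correspond to the square roots s = 2u − x of x² − 4. -/
theorem sum_units_add_inv (h2 : (2 : F) ≠ 0) (h : F → ℂ) :
    ∑ u : Fˣ, h (u + (u : F)⁻¹) = ∑ x : F, (1 + phi F (x ^ 2 - 4)) * h x := by
  have key : ∀ x : F, ((Finset.univ.filter fun u : Fˣ => (u : F) + (u : F)⁻¹ = x).card : ℂ) =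
      1 + phi F (x ^ 2 - 4) := by
    intro x
    rw [← card_sqrt_eq h2]
    congr 1
    refine Finset.card_bij (fun u _ => 2 * (u : F) - x) ?_ ?_ ?_
    · intro u hu
      have hu := (Finset.mem_filter.mp hu).2
      have h0 := u.ne_zero
      simp only [Finset.mem_filter, Finset.mem_univ, true_and]
      rw [← hu]; field_simp; ring
    · intro u _ v _ huv
      exact Units.ext (mul_left_cancel₀ h2 (by linear_combination huv))
    · intro s hs
      have hs := (Finset.mem_filter.mp hs).2
      have hne : (x + s) / 2 ≠ 0 := by
        intro h0
        have h1 : s = -x := by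
          field_simp at h0
          linear_combination h0
        rw [h1] at hs
        have : (2 : F) * 2 = 0 := by linear_combination hs
        exact h2 (mul_self_eq_zero.mp this)
      refine ⟨Units.mk0 _ hne, ?_, ?_⟩
      · simp only [Finset.mem_filter, Finset.mem_univ, true_and, Units.val_mk0]
        have hne' : x + s ≠ 0 := fun h => hne (by rw [h, zero_div])
        field_simp
        linear_combination hs
      · simp only [Units.val_mk0]; field_simp; ring
  rw [← Finset.sum_fiberwise Finset.univ (fun u : Fˣ => (u : F) + (u : F)⁻¹)]
  refine Finset.sum_congr rfl fun x _ => ?_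
  rw [Finset.sum_congr rfl (g := fun _ => h x) fun u hu => by
    rw [(Finset.mem_filter.mp hu).2], Finset.sum_const, nsmul_eq_mul, key]

/-- The substitution `x ↦ x³ - 3x` permutes the elements `x` for which `x² - 4` is not a nonzero
square, compatibly with the quadratic character of `x² - 4`. -/
theorem sum_comp_cubic {r : F} (hr : r ^ 2 = -3) (h3 : (3 : F) ≠ 0)
    (f : F → ℂ) :
    ∑ x : F, (1 - phi F (x ^ 2 - 4)) * f (x ^ 3 - 3 * x) =
      ∑ t : F, (1 - phi F (t ^ 2 - 4)) * f t := by
  have hφ : phi F (-3) = 1 := by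
    rw [← hr, phi_one_of_square]
    rintro rfl
    exact h3 (by linear_combination hr)
  set S : Finset F := Finset.univ.filter fun x => phi F (x ^ 2 - 4) ≠ 1 with hS
  have hmem : ∀ x, x ∈ S ↔ phi F (x ^ 2 - 4) ≠ 1 := by simp [hS]
  have hres : ∀ k : F → ℂ, ∑ x : F, (1 - phi F (x ^ 2 - 4)) * k x =
      ∑ x ∈ S, (1 - phi F (x ^ 2 - 4)) * k x := by
    intro k
    refine (Finset.sum_subset (Finset.subset_univ S) fun x _ hx => ?_).symm
    have : phi F (x ^ 2 - 4) = 1 := by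
      by_contra h; exact hx ((hmem x).mpr h)
    rw [this]; ring
  have hne : ∀ x ∈ S, x ^ 2 - 1 ≠ 0 := by
    intro x hx h
    refine (hmem x).mp hx ?_
    rw [← hφ]; congr 1; linear_combination h
  have hval : ∀ x ∈ S, phi F ((x ^ 3 - 3 * x) ^ 2 - 4) = phi F (x ^ 2 - 4) := by
    intro x hx
    have : (x ^ 3 - 3 * x) ^ 2 - 4 = (x ^ 2 - 4) * (x ^ 2 - 1) ^ 2 := by ring
    rw [this, map_mul, phi_one_of_square (hne x hx), mul_one]
  have hmaps : Set.MapsTo (fun x : F => x ^ 3 - 3 * x) S S := by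
    intro x hx
    simp only [Finset.mem_coe] at hx ⊢
    rw [hmem, hval x hx]; exact (hmem x).mp hx
  -- Distinct points of one fibre satisfy x² + xy + y² = 3, so −3(x² − 4) = (2y + x)². Since −3 is a
  -- square, x² − 4 is then a nonzero square unless 2y + x = 0; in that case y² = 1 and y² − 4 = −3
  -- is a nonzero square.
  have hinj : Set.InjOn (fun x : F => x ^ 3 - 3 * x) S := by
    intro x hx y hy hxy
    simp only [Finset.mem_coe] at hx hy hxy
    by_contra hne'
    have h1 : x ^ 2 + x * y + y ^ 2 - 3 = 0 := by
      apply mul_left_cancel₀ (sub_ne_zero.mpr hne')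
      linear_combination hxy
    have h4 : (-3) * (x ^ 2 - 4) = (2 * y + x) ^ 2 := by linear_combination -4 * h1
    have h5 : phi F (x ^ 2 - 4) = phi F ((2 * y + x) ^ 2) := by
      rw [← h4, map_mul, hφ, one_mul]
    by_cases h0 : 2 * y + x = 0
    · have h6 : (3 : F) * (y ^ 2 - 1) = 0 := by linear_combination h1 + (-x + y) * h0
      exact hne y hy ((mul_eq_zero.mp h6).resolve_left h3)
    · exact (hmem x).mp hx (by rw [h5, phi_one_of_square h0])
  rw [hres, hres]
  refine Finset.sum_nbij (fun x => x ^ 3 - 3 * x) (fun x hx => hmaps hx) hinj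
    (Finset.surjOn_of_injOn_of_card_le _ hmaps hinj le_rfl) fun x hx => ?_
  rw [hval x hx]

/-- The weight 1 + ρ(w) + ρ(w)² counts the cube roots of w: three if ρ(w) = 1, none otherwise. -/
theorem sum_units_cube {ρ : MulChar F ℂ} (hρ : ρ ^ 3 = 1)
    (hcube : ∀ w : Fˣ, ρ w = 1 → ∃ u : Fˣ, u ^ 3 = w) {ω : F} (hω : ω ^ 2 + ω + 1 = 0)
    (h3 : (3 : F) ≠ 0) (k : F → ℂ) :
    ∑ u : Fˣ, k ((u : F) ^ 3) = ∑ w : Fˣ, (1 + ρ w + ρ w ^ 2) * k w := by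
  have hρ3 : ∀ w : Fˣ, ρ w ^ 3 = 1 := by
    intro w
    rw [← MulChar.pow_apply_coe, hρ, MulChar.one_apply_coe]
  have hω0 : ω ≠ 0 := by rintro rfl; simp at hω
  have hω3 : ω ^ 3 = 1 := by linear_combination (ω - 1) * hω
  have hω1 : ω ≠ 1 := by
    rintro rfl
    exact h3 (by linear_combination hω)
  set z : Fˣ := Units.mk0 ω hω0
  have hz : (z : F) = ω := rfl
  have key : ∀ w : Fˣ, ((Finset.univ.filter fun u : Fˣ => u ^ 3 = w).card : ℂ) =
      1 + ρ w + ρ w ^ 2 := by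
    intro w
    by_cases hw : ρ w = 1
    · obtain ⟨u₀, hu₀⟩ := hcube w hw
      have : (Finset.univ.filter fun u : Fˣ => u ^ 3 = w) = {u₀, z * u₀, z * z * u₀} := by
        ext u
        simp only [Finset.mem_filter, Finset.mem_univ, true_and, Finset.mem_insert,
          Finset.mem_singleton, ← hu₀]
        simp only [Units.ext_iff, Units.val_mul, Units.val_pow_eq_pow_val, hz]
        constructor
        · intro h
          have : ((u : F) - u₀) * ((u - ω * u₀) * (u - ω * ω * u₀)) = 0 := by
            linear_combination h + (-(u : F) ^ 2 * u₀ +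
              u * ω * (u₀ : F) ^ 2 - (u₀ : F) ^ 3 * (ω - 1)) * hω
          rcases mul_eq_zero.mp this with h | h
          · exact Or.inl (sub_eq_zero.mp h)
          · rcases mul_eq_zero.mp h with h | h
            · exact Or.inr (Or.inl (sub_eq_zero.mp h))
            · exact Or.inr (Or.inr (sub_eq_zero.mp h))
        · rintro (h | h | h) <;> rw [h]
          · linear_combination (u₀ : F) ^ 3 * hω3
          · linear_combination (u₀ : F) ^ 3 * (ω ^ 3 + 1) * hω3
      rw [this, hw]
      have hu : (u₀ : F) ≠ 0 := u₀.ne_zero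
      rw [Finset.card_insert_of_notMem, Finset.card_insert_of_notMem, Finset.card_singleton]
      · norm_num
      · simp only [Finset.mem_singleton, Units.ext_iff, Units.val_mul, hz]
        intro h
        apply hω1
        apply mul_left_cancel₀ (mul_ne_zero hω0 hu)
        linear_combination -h
      · simp only [Finset.mem_insert, Finset.mem_singleton, Units.ext_iff, Units.val_mul, hz,
          not_or]
        refine ⟨fun h => hω1 (mul_left_cancel₀ hu (by linear_combination -h)), fun h => hω1 ?_⟩
        apply mul_left_cancel₀ hu
        linear_combination ω * h + u₀ * hω3
    · have h1 : (Finset.univ.filter fun u : Fˣ => u ^ 3 = w) = ∅ := by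
        refine Finset.filter_eq_empty_iff.mpr fun u _ hu => hw ?_
        rw [← hu, Units.val_pow_eq_pow_val, map_pow, hρ3]
      rw [h1]
      have : (ρ w - 1) * (1 + ρ w + ρ w ^ 2) = 0 := by linear_combination hρ3 w
      rw [(mul_eq_zero.mp this).resolve_left (sub_ne_zero.mpr hw)]
      simp
  rw [← Finset.sum_fiberwise Finset.univ (fun u : Fˣ => u ^ 3)]
  refine Finset.sum_congr rfl fun w _ => ?_
  rw [Finset.sum_congr rfl (g := fun _ => k w) fun u hu => by
    rw [← (Finset.mem_filter.mp hu).2, Units.val_pow_eq_pow_val], Finset.sum_const, nsmul_eq_mul,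
    key]

/-- Cardano's formula in summed form: the number of roots of `x³ - 3x = t` is
`1 + ∑ ρ(w)` over the `w` with `w + w⁻¹ = t`, for a cubic character `ρ`. -/
theorem sum_cardano {ρ : MulChar F ℂ} (hρ : ρ ^ 3 = 1)
    (hcube : ∀ w : Fˣ, ρ w = 1 → ∃ u : Fˣ, u ^ 3 = w) {ω : F} (hω : ω ^ 2 + ω + 1 = 0)
    (h2 : (2 : F) ≠ 0) (h3 : (3 : F) ≠ 0) (f : F → ℂ) :
    ∑ x : F, f (x ^ 3 - 3 * x) = ∑ t : F, f t + ∑ w : Fˣ, ρ w * f (w + (w : F)⁻¹) := by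
  have hinv : ∀ w : Fˣ, ρ ((w⁻¹ : Fˣ) : F) = ρ w ^ 2 := by
    intro w
    have h1 : ρ ((w⁻¹ : Fˣ) : F) * ρ w = 1 := by rw [← map_mul]; simp
    have h3 : ρ w ^ 3 = 1 := by rw [← MulChar.pow_apply_coe, hρ, MulChar.one_apply_coe]
    linear_combination ρ w ^ 2 * h1 - ρ ((w⁻¹ : Fˣ) : F) * h3
  have e1 : ∑ w : Fˣ, ρ w ^ 2 * f (w + (w : F)⁻¹) = ∑ w : Fˣ, ρ w * f (w + (w : F)⁻¹) := by
    refine Fintype.sum_equiv (Equiv.inv Fˣ) _ _ fun w => ?_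
    rw [Equiv.inv_apply, hinv]
    simp [add_comm]
  have e2 := sum_units_cube hρ hcube hω h3 fun w => f (w + w⁻¹)
  -- With x = u + u⁻¹ one has x³ − 3x = u³ + u⁻³. This reaches the x with weight 1 + φ(x² − 4);
  -- `sum_comp_cubic` supplies the complementary weight 1 − φ(x² − 4).
  have e3 : ∑ u : Fˣ, f ((u : F) ^ 3 + ((u : F) ^ 3)⁻¹) =
      ∑ x : F, (1 + phi F (x ^ 2 - 4)) * f (x ^ 3 - 3 * x) := by
    rw [← sum_units_add_inv h2 fun x => f (x ^ 3 - 3 * x)]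
    refine Finset.sum_congr rfl fun u _ => congrArg f ?_
    have := u.ne_zero
    field_simp; ring
  have e4 := sum_units_add_inv h2 f
  have e5 := sum_comp_cubic (r := 2 * ω + 1) (by linear_combination 4 * hω) h3 f
  simp only [add_mul, sub_mul, one_mul, Finset.sum_add_distrib,
    Finset.sum_sub_distrib] at e2 e3 e4 e5
  have h2' : (2 : ℂ) ≠ 0 := two_ne_zero
  apply mul_left_cancel₀ h2'
  linear_combination e5 - e3 + e2 + e4 + e1

/-- Apply `sum_cardano` to f(t) = B(t − 2). Both sides factor: x³ − 3x − 2 = (x − 2)(x + 1)², which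
is −27y(1 − y)² at x = 2 − 3y, and w + w⁻¹ − 2 = (1 − w)²/w. -/
theorem jacobiSum_cubic {ρ : MulChar F ℂ} (hρ : ρ ^ 3 = 1)
    (hcube : ∀ w : Fˣ, ρ w = 1 → ∃ u : Fˣ, u ^ 3 = w) {ω : F} (hω : ω ^ 2 + ω + 1 = 0)
    (h2 : (2 : F) ≠ 0) (h3 : (3 : F) ≠ 0) {B : MulChar F ℂ} (hB : B ≠ 1) :
    jacobiSum (ρ * B⁻¹) (B * B) = B (-27) * jacobiSum B (B * B) := by
  have key := sum_cardano hρ hcube hω h2 h3 fun t => B (t - 2)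
  have e0 : ∑ t : F, B (t - 2) = 0 := by
    have := sum_comp_affine one_ne_zero (-2 : F) B
    simp only [one_mul, neg_add_eq_sub] at this
    rw [this, MulChar.sum_eq_zero_of_ne_one hB]
  have e1 : ∑ x : F, B (x ^ 3 - 3 * x - 2) = B (-27) * jacobiSum B (B * B) := by
    rw [← sum_comp_affine (neg_ne_zero.mpr h3) 2, jacobiSum, Finset.mul_sum]
    refine Finset.sum_congr rfl fun y _ => ?_
    rw [MulChar.mul_apply, ← map_mul, ← map_mul, ← map_mul]; congr 1; ring
  have e2 : ∑ w : Fˣ, ρ w * B (w + (w : F)⁻¹ - 2) = jacobiSum (ρ * B⁻¹) (B * B) := by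
    rw [jacobiSum, Fintype.sum_eq_add_sum_compl (0 : F)]
    simp only [MulChar.map_zero, zero_mul, zero_add]
    symm
    refine Finset.sum_bij' (fun w hw => Units.mk0 w (by simpa using hw)) (fun w _ => (w : F))
      (by simp) (by simp) (by simp) (by simp) ?_
    intro w hw
    have hw0 : w ≠ 0 := by simpa using hw
    rw [MulChar.mul_apply, MulChar.mul_apply, MulChar.inv_apply', mul_assoc, ← map_mul, ← map_mul,
      Units.val_mk0]
    congr 2; field_simp; ring
  rw [← e2, ← e1, key, e0, zero_add]

/-- The Hasse–Davenport triplication formula, in the form involving a reflected Gauss sum. -/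
theorem gaussSum_triplication {ρ : MulChar F ℂ} (hρ : ρ ^ 3 = 1)
    (hcube : ∀ w : Fˣ, ρ w = 1 → ∃ u : Fˣ, u ^ 3 = w) {ω : F} (hω : ω ^ 2 + ω + 1 = 0)
    (h2 : (2 : F) ≠ 0) (h3 : (3 : F) ≠ 0) {β : MulChar F ℂ} (hβ : β ≠ 1)
    {ψ : AddChar F ℂ} (hψ : ψ.IsPrimitive) :
    β (-27) * (gaussSum (ρ * β) ψ * gaussSum (ρ ^ 2 * β) ψ) =
      gaussSum β⁻¹ ψ * gaussSum (β ^ 3) ψ := by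
  have hB : β⁻¹ ≠ 1 := inv_ne_one.mpr hβ
  have key := jacobiSum_cubic hρ hcube hω h2 h3 hB
  rw [inv_inv] at key
  have hρ1 : ρ (-1) = 1 := MulChar.val_neg_one_eq_one_of_odd_order (by decide) hρ
  have h1 : ¬(ρ * β = 1 ∧ β⁻¹ * β⁻¹ = 1) := by
    rintro ⟨ha, hb⟩
    have hb' : β * β = 1 := by rw [← inv_inj, mul_inv, hb, inv_one]
    have : β ^ 3 = 1 := by
      have := congrArg (· ^ 3) ha
      simpa [mul_pow, hρ] using this
    exact hβ (by rw [pow_succ, sq, hb', one_mul] at this; exact this)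
  -- Both Jacobi sums contain the factor G(β⁻²), which cancels in the comparison.
  have j1 := card_mul_jacobiSum h1 hψ
  have j2 := card_mul_jacobiSum (A := β⁻¹) (B := β⁻¹ * β⁻¹) (fun h => hB h.1) hψ
  have c1 : (ρ * β * (β⁻¹ * β⁻¹))⁻¹ = ρ ^ 2 * β := by
    rw [inv_eq_iff_mul_eq_one]
    calc ρ * β * (β⁻¹ * β⁻¹) * (ρ ^ 2 * β) = ρ ^ 3 * (β * β⁻¹) * (β * β⁻¹) := by
          rw [pow_succ ρ 2]; ac_rfl
      _ = 1 := by rw [hρ, mul_inv_cancel, one_mul, one_mul]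
  have c2 : (β⁻¹ * (β⁻¹ * β⁻¹))⁻¹ = β ^ 3 := by
    rw [mul_inv, mul_inv, inv_inv, pow_succ', sq]
  rw [c1] at j1
  rw [c2] at j2
  have h27 : (-27 : F) ≠ 0 := by
    have : (-27 : F) = -(3 * 3 * 3) := by norm_num
    rw [this]; exact neg_ne_zero.mpr (mul_ne_zero (mul_ne_zero h3 h3) h3)
  have hb27 : β (-27) * β⁻¹ (-27) = 1 := by
    rw [MulChar.inv_apply', ← map_mul, mul_inv_cancel₀ h27, map_one]
  simp only [MulChar.mul_apply, inv_apply_neg_one, hρ1, one_mul] at j1 j2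
  have hs := apply_neg_one_sq β
  set s := β (-1) with hs'
  have hg := gaussSum_ne_zero (β⁻¹ * β⁻¹) hψ
  have hs0 : s ≠ 0 := by intro h; rw [h] at hs; simp at hs
  apply mul_left_cancel₀ (mul_ne_zero hg (mul_ne_zero hs0 (mul_ne_zero hs0 hs0)))
  linear_combination β (-27) * (Fintype.card F * key - j1 + β⁻¹ (-27) * j2) +
    (s * s * s * gaussSum β⁻¹ ψ * gaussSum (β⁻¹ * β⁻¹) ψ * gaussSum (β ^ 3) ψ) * hb27

end Cubic

/-! ### Linearizing the surface sum along its conic fibres. -/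

section Quartic

variable {F : Type*} [Field F] [Fintype F]

theorem sum_comp_const_sub {χ : MulChar F ℂ} (hχ : χ ≠ 1) (a : F) {b : F} (hb : b ≠ 0) :
    ∑ x : F, χ (a + b * x) = 0 := by
  rw [sum_comp_affine hb a χ, MulChar.sum_eq_zero_of_ne_one hχ]

variable [DecidableEq F]

theorem sum_eq_zero_add_sum_units (f : F → ℂ) : ∑ x : F, f x = f 0 + ∑ u : Fˣ, f u := by
  rw [Fintype.sum_eq_add_sum_compl (0 : F)]
  congr 1
  refine Finset.sum_bij' (fun w hw => Units.mk0 w (by simpa using hw)) (fun w _ => (w : F))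
    (by simp) (by simp) (by simp) (by simp) ?_
  intro w hw
  rfl

/-- A rational parametrization of the conic `k² = c² - t c + m` (put `k = c + l`) linearizes a
quadratic character sum. -/
theorem sum_mul_phi_quadratic (h2 : (2 : F) ≠ 0) {μ : MulChar F ℂ} (hμ : μ ≠ 1) (t m : F) :
    ∑ c : F, μ c * phi F (c ^ 2 - t * c + m) = ∑ l : F, μ (m - l ^ 2) * μ⁻¹ (t + 2 * l) := by
  have e1 : ∑ c : F, μ c * phi F (c ^ 2 - t * c + m) =
      ∑ c : F, ∑ l : F, if c * (t + 2 * l) = m - l ^ 2 then μ c else 0 := by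
    -- Adding Σ μ(c) = 0 replaces φ by the number of points k on the conic.
    have : ∑ c : F, μ c * phi F (c ^ 2 - t * c + m) =
        ∑ c : F, μ c * (1 + phi F (c ^ 2 - t * c + m)) := by
      simp_rw [mul_add, mul_one]
      rw [Finset.sum_add_distrib, MulChar.sum_eq_zero_of_ne_one hμ, zero_add]
    rw [this]
    refine Finset.sum_congr rfl fun c _ => ?_
    rw [← card_sqrt_eq h2, mul_comm, ← nsmul_eq_mul, ← Finset.sum_const, Finset.sum_filter,
      ← sum_comp_affine one_ne_zero c]
    refine Finset.sum_congr rfl fun l _ => ?_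
    refine if_congr ⟨fun h => by linear_combination h, fun h => by linear_combination h⟩ rfl rfl
  rw [e1, Finset.sum_comm]
  refine Finset.sum_congr rfl fun l _ => ?_
  by_cases h : t + 2 * l = 0
  · rw [h, MulChar.map_zero, mul_zero]
    by_cases h' : m - l ^ 2 = 0
    · simp [h', MulChar.sum_eq_zero_of_ne_one hμ]
    · simp [Ne.symm h']
  · rw [MulChar.inv_apply', ← map_mul, Finset.sum_eq_single ((m - l ^ 2) * (t + 2 * l)⁻¹)]
    · rw [if_pos (by rw [mul_assoc, inv_mul_cancel₀ h, mul_one])]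
    · intro c _ hc
      rw [if_neg]
      intro h'; apply hc; rw [← h']; field_simp
    · simp

/-- A two-dimensional Kloosterman-type sum over the surface `a b c = M`. -/
noncomputable def surfaceSum (E κ : MulChar F ℂ) (M : F) : ℂ :=
  ∑ a : F, ∑ c : F, E a * κ c * phi F (2 + M - a - c - M / (a * c))

/-- The form of the surface sum after both changes of variable. M occurs in one linear factor, and
the r-sum against the factor without M is a rescaled Jacobi sum. -/
noncomputable def factoredSum (E κ : MulChar F ℂ) (M : F) : ℂ :=
  ∑ r : F, ∑ s : F, E r * κ⁻¹ ((1 + s) ^ 2 - r) * κ s * κ (2 * r + M * s)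

/-- Since κ² = φ and φ(−1) = 1, the summand is κ⁻¹(c) φ(c² − tc + m). -/
theorem inner_sum_linearized (h2 : (2 : F) ≠ 0) {κ : MulChar F ℂ} (hκ : κ * κ = phi F)
    (hκ1 : κ⁻¹ ≠ 1) (hneg : phi F (-1) = 1) (t m : F) :
    ∑ c : F, κ c * phi F (t - c - m / c) = ∑ l : F, κ⁻¹ (m - l ^ 2) * κ (t + 2 * l) := by
  have h := sum_mul_phi_quadratic h2 hκ1 t m
  rw [inv_inv] at h
  rw [← h]
  refine Finset.sum_congr rfl fun c _ => ?_
  by_cases hc : c = 0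
  · simp [hc, MulChar.map_zero]
  · have h1 : c ^ 2 - t * c + m = -1 * (c * (t - c - m / c)) := by field_simp; ring
    have h3 : κ⁻¹ c * κ c = 1 := by
      rw [MulChar.inv_apply', ← map_mul, inv_mul_cancel₀ hc, map_one]
    rw [h1, map_mul, map_mul, hneg, one_mul, ← hκ, MulChar.mul_apply, MulChar.mul_apply]
    linear_combination -(κ c * (κ (t - c - m / c) * κ (t - c - m / c))) * h3

/-- With t = 2 + M − M/m, both m − l² and t + 2l are divisible by m − 1 at l = −1. For m ≠ 1 the
substitution l = −1 + (m − 1)/s makes the common factor cancel between κ⁻¹ and κ. The point l = −1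
itself, which is s = ∞, produces the term κ(M) E(m). -/
theorem fiber_sum_eq (h2 : (2 : F) ≠ 0) {E κ : MulChar F ℂ} (hκ1 : κ⁻¹ ≠ 1)
    (hE : E * E * κ = 1) {M : F} (hM1 : M ≠ 1)
    {m : F} (hm : m ≠ 0) :
    E (M / m) * ∑ l : F, κ⁻¹ (m - l ^ 2) * κ (2 + M - M / m + 2 * l) =
      E M * (κ M * E m +
        ∑ s : F, E m * κ⁻¹ ((1 + s) ^ 2 - m) * κ s * κ (2 * m + M * s)) := by
  have hκinv : ∀ x : F, x ≠ 0 → κ⁻¹ x * κ x = 1 := fun x hx => by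
    rw [MulChar.inv_apply', ← map_mul, inv_mul_cancel₀ hx, map_one]
  have hκ1' : κ ≠ 1 := fun h => hκ1 (by rw [h, inv_one])
  -- Here the substitution degenerates, and the two sums are evaluated separately as −1 and −κ(M) −
  -- 1. The second value needs M ≠ 1, the source of the condition x ≠ −1/8.
  by_cases hm1 : m = 1
  · subst hm1
    have a1 : ∑ l : F, κ⁻¹ (1 - l ^ 2) * κ (2 + M - M / 1 + 2 * l) = -1 := by
      have : ∀ l : F, κ⁻¹ (1 - l ^ 2) * κ (2 + M - M / 1 + 2 * l) =
          κ 2 * κ⁻¹ (1 + -1 * l) - if l = -1 then 1 else 0 := by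
        intro l
        split_ifs with hl
        · rw [hl]
          have : (1 : F) + -1 * -1 = 2 := by norm_num
          rw [this, mul_comm (κ 2), hκinv 2 h2]; simp [MulChar.map_zero]
        · have hl' : 1 + l ≠ 0 := fun h => hl (by linear_combination h)
          have t1 : 1 - l ^ 2 = (1 + l) * (1 + -1 * l) := by ring
          have t2 : 2 + M - M / 1 + 2 * l = 2 * (1 + l) := by rw [div_one]; ring
          rw [t1, t2, map_mul, map_mul]
          linear_combination (κ 2 * κ⁻¹ (1 + -1 * l)) * hκinv _ hl'
      simp_rw [this]
      rw [Finset.sum_sub_distrib, ← Finset.mul_sum, sum_comp_const_sub hκ1 1 (by simp)]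
      simp
    have a2 : ∑ s : F, E 1 * κ⁻¹ ((1 + s) ^ 2 - 1) * κ s * κ (2 * 1 + M * s) = -κ M - 1 := by
      have : ∀ s : F, E 1 * κ⁻¹ ((1 + s) ^ 2 - 1) * κ s * κ (2 * 1 + M * s) =
          κ⁻¹ (2 + 1 * s) * κ (2 + M * s) - if s = 0 then 1 else 0 := by
        intro s
        split_ifs with hs
        · rw [hs]; simp [hκinv 2 h2, MulChar.map_zero]
        · have t1 : (1 + s) ^ 2 - 1 = s * (2 + 1 * s) := by ring
          rw [t1, map_one, map_mul, mul_one]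
          linear_combination (κ⁻¹ (2 + 1 * s) * κ (2 + M * s)) * hκinv s hs
      simp_rw [this]
      rw [Finset.sum_sub_distrib]
      have b1 : ∑ s : F, κ⁻¹ (2 + 1 * s) * κ (2 + M * s) =
          ∑ v : F, κ⁻¹ v * κ (2 - 2 * M + M * v) := by
        rw [← sum_comp_affine one_ne_zero 2 fun v => κ⁻¹ v * κ (2 - 2 * M + M * v)]
        refine Finset.sum_congr rfl fun s _ => ?_
        congr 2; ring
      have b2 : ∑ v : F, κ⁻¹ v * κ (2 - 2 * M + M * v) = -κ M := by
        rw [← Fintype.sum_bijective _ (inv_involutive (G := F)).bijective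
          (fun v => κ v * κ (2 - 2 * M + M * v⁻¹)) _ fun v => by rw [MulChar.inv_apply', inv_inv]]
        have hM2 : 2 - 2 * M ≠ 0 := fun h =>
          hM1 (mul_left_cancel₀ h2 (by linear_combination -h))
        have c1 := sum_comp_const_sub hκ1' M hM2
        rw [sum_eq_zero_add_sum_units] at c1 ⊢
        rw [MulChar.map_zero, zero_mul, zero_add]
        rw [mul_zero, add_zero] at c1
        rw [← eq_neg_iff_add_eq_zero.mpr ((add_comm _ _).trans c1)]
        refine Finset.sum_congr rfl fun u _ => ?_
        have := u.ne_zero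
        rw [← map_mul]; congr 1; field_simp; ring
      rw [b1, b2]; simp
    rw [a1, a2, div_one, map_one]; ring
  · have hd : m - 1 ≠ 0 := sub_ne_zero.mpr hm1
    have hEm : E (M / m) = E M * (E m * κ m) := by
      have h1 : E m * E m * κ m = 1 := by
        rw [← MulChar.mul_apply, ← MulChar.mul_apply, hE,
          MulChar.one_apply (isUnit_iff_ne_zero.mpr hm)]
      have h3 : E (M / m) * E m = E M := by rw [← map_mul, div_mul_cancel₀ _ hm]
      linear_combination (E m * κ m) * h3 - E (M / m) * h1
    rw [← sum_comp_affine one_ne_zero (-1) fun l =>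
        κ⁻¹ (m - l ^ 2) * κ (2 + M - M / m + 2 * l), sum_eq_zero_add_sum_units,
      sum_eq_zero_add_sum_units fun s => E m * κ⁻¹ ((1 + s) ^ 2 - m) * κ s * κ (2 * m + M * s)]
    have a0 : κ⁻¹ (m - (-1 + 1 * 0) ^ 2) * κ (2 + M - M / m + 2 * (-1 + 1 * 0)) =
        κ M * κ⁻¹ m := by
      have t1 : m - (-1 + 1 * 0) ^ 2 = m - 1 := by ring
      have t2 : 2 + M - M / m + 2 * (-1 + 1 * 0) = (m - 1) * (M * m⁻¹) := by field_simp; ring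
      rw [t1, t2, map_mul, map_mul κ M, MulChar.inv_apply' κ m]
      linear_combination (κ M * κ m⁻¹) * hκinv _ hd
    have a1 : ∑ u : Fˣ, κ⁻¹ (m - (-1 + 1 * (u : F)) ^ 2) *
          κ (2 + M - M / m + 2 * (-1 + 1 * (u : F))) =
        κ⁻¹ m * ∑ s : Fˣ, κ⁻¹ ((1 + (s : F)) ^ 2 - m) * κ s * κ (2 * m + M * s) := by
      rw [Finset.mul_sum]
      refine Fintype.sum_equiv (Equiv.divLeft (Units.mk0 _ hd)) _ _ fun u => ?_
      have hu := u.ne_zero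
      simp only [Equiv.divLeft_apply, Units.val_div_eq_div_val, Units.val_mk0]
      set s : F := (m - 1) / u with hs
      have t1 : m - (-1 + 1 * (u : F)) ^ 2 = u * (s⁻¹ * ((1 + s) ^ 2 - m)) := by
        rw [hs]; field_simp; ring
      have t2 : 2 + M - M / m + 2 * (-1 + 1 * (u : F)) = u * (m⁻¹ * (2 * m + M * s)) := by
        rw [hs]; field_simp; ring
      have t3 : κ⁻¹ s⁻¹ = κ s := by rw [MulChar.inv_apply', inv_inv]
      rw [t1, t2, map_mul, map_mul, map_mul, map_mul, t3, MulChar.inv_apply' κ m]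
      linear_combination (κ s * κ⁻¹ ((1 + s) ^ 2 - m) * κ m⁻¹ * κ (2 * m + M * s)) * hκinv _ hu
    have a2 : ∑ s : Fˣ, E m * κ⁻¹ ((1 + (s : F)) ^ 2 - m) * κ s * κ (2 * m + M * s) =
        E m * ∑ s : Fˣ, κ⁻¹ ((1 + (s : F)) ^ 2 - m) * κ s * κ (2 * m + M * s) := by
      rw [Finset.mul_sum]
      exact Finset.sum_congr rfl fun s _ => by ring
    rw [a0, a1, a2, hEm, MulChar.map_zero]
    set Z := ∑ s : Fˣ, κ⁻¹ ((1 + (s : F)) ^ 2 - m) * κ s * κ (2 * m + M * s)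
    linear_combination (E M * E m * (κ M + Z)) * hκinv m hm

/-- Sum `fiber_sum_eq` over m = M/a; the extra terms κ(M) E(m) add up to 0 because E is nontrivial.
-/
theorem surfaceSum_eq (h2 : (2 : F) ≠ 0) {E κ : MulChar F ℂ} (hκ : κ * κ = phi F)
    (hκ1 : κ⁻¹ ≠ 1) (hE1 : E ≠ 1) (hE : E * E * κ = 1) (hneg : κ (-1) = 1) {M : F}
    (hM0 : M ≠ 0) (hM1 : M ≠ 1) :
    surfaceSum E κ M = E M * factoredSum E κ M := by
  have hφneg : phi F (-1) = 1 := by rw [← hκ, MulChar.mul_apply, hneg, one_mul]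
  have e1 : surfaceSum E κ M = ∑ a : F, E a * ∑ l : F, κ⁻¹ (M / a - l ^ 2) *
      κ (2 + M - a + 2 * l) := by
    refine Finset.sum_congr rfl fun a _ => ?_
    rw [← inner_sum_linearized h2 hκ hκ1 hφneg, Finset.mul_sum]
    exact Finset.sum_congr rfl fun c _ => by rw [div_div, mul_assoc]
  have hbij : Function.Bijective fun m : F => M / m := by
    refine Function.Involutive.bijective fun m => ?_
    rcases eq_or_ne m 0 with rfl | hm
    · simp
    · exact div_div_cancel₀ hM0
  rw [e1, ← Fintype.sum_bijective _ hbij (fun m => E (M / m) * ∑ l : F,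
    κ⁻¹ (M / (M / m) - l ^ 2) * κ (2 + M - M / m + 2 * l)) _ fun _ => rfl]
  have e2 : ∀ m : F, E (M / m) * ∑ l : F,
      κ⁻¹ (M / (M / m) - l ^ 2) * κ (2 + M - M / m + 2 * l) =
      E M * (κ M * E m +
        ∑ s : F, E m * κ⁻¹ ((1 + s) ^ 2 - m) * κ s * κ (2 * m + M * s)) := by
    intro m
    rcases eq_or_ne m 0 with rfl | hm
    · simp [MulChar.map_zero]
    · rw [div_div_cancel₀ hM0, fiber_sum_eq h2 hκ1 hE hM1 hm]
  simp_rw [e2]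
  rw [← Finset.mul_sum, Finset.sum_add_distrib, ← Finset.mul_sum,
    MulChar.sum_eq_zero_of_ne_one hE1, mul_zero, zero_add, factoredSum]

end Quartic

/-! ### Mellin transform of the factored sum, and its dihedral evaluation. -/

section Transform

variable {F : Type*} [Field F] [Fintype F]

theorem exists_isPrimitive (F : Type*) [Field F] [Fintype F] :
    ∃ ψ : AddChar F ℂ, ψ.IsPrimitive := by
  obtain ⟨ψ, hψ⟩ := AddChar.exists_apply_ne_zero.mpr (one_ne_zero (α := F))
  exact ⟨ψ, AddChar.IsPrimitive.of_ne_one fun h => hψ (by rw [h, AddChar.one_apply])⟩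

theorem sum_mul_comp_affine (A B : MulChar F ℂ) {c d : F} (hc : c ≠ 0) (hd : d ≠ 0) :
    ∑ x : F, A x * B (c + d * x) = A (-c / d) * B c * jacobiSum A B := by
  rw [← sum_comp_affine (div_ne_zero (neg_ne_zero.mpr hc) hd) 0 fun x => A x * B (c + d * x),
    jacobiSum, Finset.mul_sum]
  refine Finset.sum_congr rfl fun y _ => ?_
  have t1 : c + d * (0 + -c / d * y) = c * (1 - y) := by field_simp; ring
  rw [t1, zero_add, map_mul, map_mul]; ring

theorem sum_mul_comp_sub (A B : MulChar F ℂ) {c : F} (hc : c ≠ 0) :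
    ∑ x : F, A x * B (c - x) = (A * B) c * jacobiSum A B := by
  have h := sum_mul_comp_affine A B hc (d := -1) (by simp)
  simp only [neg_mul, one_mul, ← sub_eq_add_neg] at h
  rw [h, MulChar.mul_apply, neg_div_neg_eq, div_one]

variable [DecidableEq F]

theorem sum_mulChar (C : MulChar F ℂ) [Decidable (C = 1)] :
    ∑ r : F, C r = if C = 1 then (Fintype.card F : ℂ) - 1 else 0 := by
  split_ifs with h
  · rw [h, MulChar.sum_one_eq_card_units, Fintype.card_units,
      Nat.cast_sub Fintype.card_pos, Nat.cast_one]
  · exact MulChar.sum_eq_zero_of_ne_one h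

/-- The Mellin transform of `factoredSum`, up to elementary factors a product of two Jacobi sums
with a correction at one character. -/
noncomputable def kernelTransform (E κ χ : MulChar F ℂ) : ℂ :=
  open Classical in
  jacobiSum (E * κ * χ) κ⁻¹ * jacobiSum (κ * χ⁻¹) (E * χ * (E * χ)) +
    if E * χ = 1 then (Fintype.card F : ℂ) - 1 else 0

/-- For s ≠ −1, scaling r by (1 + s)² leaves a Jacobi sum. At s = −1 the inner sum is Σ (Eχ)(r),
which accounts for the correction in `kernelTransform`. -/
theorem sum_sum_kernel {E κ : MulChar F ℂ} (hneg : κ (-1) = 1) (χ : MulChar F ℂ) :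
    ∑ s : F, (κ * χ⁻¹) s * ∑ r : F, (E * κ * χ) r * κ⁻¹ ((1 + s) ^ 2 - r) =
      χ (-1) * kernelTransform E κ χ := by
  classical
  set A := E * κ * χ
  set D := κ * χ⁻¹
  set C := E * χ
  have hC : A * κ⁻¹ = C := by
    simp only [A, C]
    rw [mul_right_comm E κ χ, mul_inv_cancel_right]
  have hneg' : κ⁻¹ (-1) = 1 := by rw [inv_apply_neg_one, hneg]
  have hD : D (-1) = χ (-1) := by
    simp only [D]; rw [MulChar.mul_apply, hneg, inv_apply_neg_one, one_mul]
  have e1 : ∀ s : F, ∑ r : F, A r * κ⁻¹ ((1 + s) ^ 2 - r) =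
      (C * C) (1 + s) * jacobiSum A κ⁻¹ + if s = -1 then ∑ r : F, C r else 0 := by
    intro s
    split_ifs with hs
    · rw [hs]
      have : (1 : F) + -1 = 0 := by ring
      rw [this, MulChar.map_zero, zero_mul, zero_add]
      refine Finset.sum_congr rfl fun r _ => ?_
      have : (0 : F) ^ 2 - r = -1 * r := by ring
      rw [this, map_mul, hneg', one_mul, ← MulChar.mul_apply, hC]
    · have hs' : 1 + s ≠ 0 := fun h => hs (by linear_combination h)
      rw [sum_mul_comp_sub A κ⁻¹ (pow_ne_zero 2 hs'), hC, sq, map_mul, ← MulChar.mul_apply,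
        add_zero]
  have e2 : ∑ s : F, D s * (C * C) (1 + s) = D (-1) * jacobiSum D (C * C) := by
    have := sum_mul_comp_affine D (C * C) one_ne_zero one_ne_zero
    simpa using this
  simp_rw [e1, mul_add]
  rw [Finset.sum_add_distrib]
  simp only [mul_ite, mul_zero, Finset.sum_ite_eq', Finset.mem_univ, if_true]
  have e3 : ∑ s : F, D s * ((C * C) (1 + s) * jacobiSum A κ⁻¹) =
      (∑ s : F, D s * (C * C) (1 + s)) * jacobiSum A κ⁻¹ := by
    rw [Finset.sum_mul]; exact Finset.sum_congr rfl fun s _ => by ring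
  rw [e3, e2, hD, sum_mulChar, kernelTransform]
  ring

theorem mellin_factoredSum (h2 : (2 : F) ≠ 0) {E κ : MulChar F ℂ} (hneg : κ (-1) = 1)
    (χ : MulChar F ℂ) :
    ∑ M : F, χ M * factoredSum E κ M =
      χ (-2) * κ 2 * jacobiSum χ κ * (χ (-1) * kernelTransform E κ χ) := by
  rw [← sum_sum_kernel hneg, Finset.mul_sum]
  simp_rw [factoredSum, Finset.mul_sum]
  rw [Finset.sum_congr rfl fun M _ => Finset.sum_comm, Finset.sum_comm]
  refine Finset.sum_congr rfl fun s _ => ?_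
  rw [Finset.sum_comm]
  refine Finset.sum_congr rfl fun r _ => ?_
  rcases eq_or_ne s 0 with rfl | hs
  · simp [MulChar.map_zero]
  rcases eq_or_ne r 0 with rfl | hr
  · simp [MulChar.map_zero]
  have h := sum_mul_comp_affine χ κ (mul_ne_zero h2 hr) hs
  have t : -(2 * r) / s = -2 * (r * s⁻¹) := by field_simp
  rw [t, map_mul, map_mul, map_mul κ, ← MulChar.inv_apply'] at h
  simp only [MulChar.mul_apply]
  rw [Finset.sum_congr rfl (g := fun M => E r * κ⁻¹ ((1 + s) ^ 2 - r) * κ s *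
    (χ M * κ (2 * r + s * M))) fun M _ => by rw [mul_comm M s]; ring, ← Finset.mul_sum, h]
  ring

/-- Duplication turns G((Eχ)²)G(φ)/G(Eχ) into (Eχ)(4) G(Eχφ). The correction term in
`kernelTransform` is exactly what keeps the formula valid at Eχ = 1. -/
theorem kernelTransform_gauss (h2 : (2 : F) ≠ 0) {E κ : MulChar F ℂ}
    (hκ1 : κ ≠ 1) (hE : E * E * κ = 1) (hneg : κ (-1) = 1)
    (χ : MulChar F ℂ) {ψ : AddChar F ℂ} (hψ : ψ.IsPrimitive) :
    Fintype.card F * kernelTransform E κ χ * gaussSum (phi F) ψ =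
      χ (-1) * (E * χ) 4 * (gaussSum (E * κ * χ) ψ * gaussSum κ⁻¹ ψ * gaussSum (κ * χ⁻¹) ψ *
        gaussSum χ⁻¹ ψ * gaussSum (E * χ * phi F) ψ) := by
  classical
  have hE' := congrArg Additive.ofMul hE
  simp only [ofMul_mul, ofMul_one] at hE'
  by_cases hC : E * χ = 1
  · have hχ : χ = E⁻¹ := eq_inv_of_mul_eq_one_right hC
    have i1 : E * κ * χ = κ := by rw [mul_right_comm, hC, one_mul]
    have i2 : κ * χ⁻¹ = E⁻¹ := by
      rw [hχ, inv_inv, eq_inv_iff_mul_eq_one, ← hE, mul_assoc, mul_comm]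
    have hE1 : E ≠ 1 := by
      rintro rfl
      exact hκ1 (by simpa using hE)
    have r1 := gaussSum_mul_gaussSum_inv hκ1 hψ
    have r2 := gaussSum_mul_gaussSum_inv hE1 hψ
    rw [kernelTransform, hC, if_pos rfl, i1, i2, one_mul, one_mul, hχ, inv_inv,
      jacobiSum_nontrivial_inv hκ1, jacobiSum_comm, jacobiSum_one_nontrivial (inv_ne_one.mpr hE1),
      hneg, inv_apply_neg_one, MulChar.one_apply (isUnit_iff_ne_zero.mpr (by
        rw [show (4 : F) = 2 * 2 by norm_num]; exact mul_ne_zero h2 h2))]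
    rw [hneg] at r1
    linear_combination -(E (-1) * gaussSum (phi F) ψ * gaussSum E ψ * gaussSum E⁻¹ ψ) * r1 -
      (E (-1) * gaussSum (phi F) ψ * Fintype.card F) * r2 -
      (gaussSum (phi F) ψ * Fintype.card F * Fintype.card F) * apply_neg_one_sq E
  · have i0 : E * κ * χ * κ⁻¹ = E * χ := by rw [mul_right_comm E κ χ, mul_inv_cancel_right]
    have j1 := jacobiSum_mul_nontrivial (χ := E * κ * χ) (φ := κ⁻¹) (by rwa [i0]) ψ
    rw [i0] at j1
    have i1 : κ * χ⁻¹ * (E * χ * (E * χ)) = χ := by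
      apply Additive.ofMul.injective
      simp only [ofMul_mul, ofMul_inv]
      linear_combination (norm := module) (1 : ℤ) • hE'
    have j2 := card_mul_jacobiSum (A := κ * χ⁻¹) (B := E * χ * (E * χ)) (fun h => hκ1 (by
      rw [h.1, h.2, one_mul] at i1
      rw [← i1, inv_one, mul_one] at h
      exact h.1)) hψ
    have d := gaussSum_duplication h2 (E * χ) hψ
    rw [i1] at j2
    simp only [MulChar.mul_apply, inv_apply_neg_one, hneg] at j2
    have hs := apply_neg_one_sq χ
    have hs' := apply_neg_one_sq E
    rw [kernelTransform, if_neg hC, add_zero]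
    apply mul_left_cancel₀ (gaussSum_ne_zero (E * χ) hψ)
    have j2' : Fintype.card F * jacobiSum (κ * χ⁻¹) (E * χ * (E * χ)) = χ (-1) *
      (gaussSum (κ * χ⁻¹) ψ * gaussSum (E * χ * (E * χ)) ψ * gaussSum χ⁻¹ ψ) := by
      rw [j2]
      linear_combination (χ (-1) * χ (-1) * χ (-1) * gaussSum (κ * χ⁻¹) ψ * gaussSum (E * χ *
        (E * χ)) ψ * gaussSum χ⁻¹ ψ) * hs' +
        (χ (-1) * gaussSum (κ * χ⁻¹) ψ * gaussSum (E * χ * (E * χ)) ψ * gaussSum χ⁻¹ ψ) * hs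
    linear_combination (Fintype.card F * jacobiSum (κ * χ⁻¹) (E * χ * (E * χ)) *
      gaussSum (phi F) ψ) * j1 + gaussSum (E * κ * χ) ψ * gaussSum κ⁻¹ ψ * gaussSum (phi F) ψ *
      j2' - χ (-1) * gaussSum (E * κ * χ) ψ * gaussSum κ⁻¹ ψ * gaussSum (κ * χ⁻¹) ψ *
      gaussSum χ⁻¹ ψ * d

/-- A second duplication merges G(κχ⁻¹) with G((χκ)⁻¹) = G(κχ⁻¹φ). What is left over is G(χ)G(χ⁻¹),
equal to 1 rather than χ(−1)q at χ = 1. -/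
theorem jacobiSum_mul_kernelTransform (h2 : (2 : F) ≠ 0) {E κ : MulChar F ℂ}
    (hκ : κ * κ = phi F) (hκ1 : κ ≠ 1) (hE : E * E * κ = 1) (hneg : κ (-1) = 1)
    (χ : MulChar F ℂ) [Decidable (χ = 1)] :
    jacobiSum χ κ * kernelTransform E κ χ * (κ * χ⁻¹) 4 =
      (E * χ) 4 * jacobiSum (E * κ * χ) (E * κ * κ * χ) *
        if χ = 1 then 1 else χ (-1) * Fintype.card F := by
  obtain ⟨ψ, hψ⟩ := exists_isPrimitive F
  have hκφ := congrArg Additive.ofMul hκ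
  have hφφ := congrArg Additive.ofMul (phi_mul_phi (F := F))
  have hE' := congrArg Additive.ofMul hE
  simp only [ofMul_mul, ofMul_one] at hE' hκφ hφφ
  have i1 : (χ * κ)⁻¹ = κ * χ⁻¹ * phi F := by
    apply Additive.ofMul.injective
    simp only [ofMul_mul, ofMul_inv]
    linear_combination (norm := module) (-1 : ℤ) • hκφ + (-1 : ℤ) • hφφ
  have i2 : E * χ * phi F = E * κ * κ * χ := by
    apply Additive.ofMul.injective
    simp only [ofMul_mul]
    linear_combination (norm := module) (-1 : ℤ) • hκφ
  have i3 : (E * κ * χ * (E * κ * κ * χ))⁻¹ = κ * χ⁻¹ * (κ * χ⁻¹) := by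
    apply Additive.ofMul.injective
    simp only [ofMul_mul, ofMul_inv]
    linear_combination (norm := module) (-1 : ℤ) • hE' + (-2 : ℤ) • hκφ + (-1 : ℤ) • hφφ
  have k := kernelTransform_gauss h2 hκ1 hE hneg χ hψ
  have j := card_mul_jacobiSum (A := χ) (B := κ) (fun h => hκ1 h.2) hψ
  have d := gaussSum_duplication h2 (κ * χ⁻¹) hψ
  have j' := card_mul_jacobiSum (A := E * κ * χ) (B := E * κ * κ * χ) (fun h => hκ1 (by
    rw [mul_right_comm (E * κ) κ χ, h.1, one_mul] at h
    exact h.2)) hψ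
  have rκ := gaussSum_mul_gaussSum_inv hκ1 hψ
  have rχ : gaussSum χ ψ * gaussSum χ⁻¹ ψ = if χ = 1 then 1 else χ (-1) * Fintype.card F := by
    split_ifs with h
    · rw [h, inv_one, gaussSum_one hψ]; norm_num
    · exact gaussSum_mul_gaussSum_inv h hψ
  rw [← rχ]
  have hsA : (E * κ * χ) (-1) * (E * κ * κ * χ) (-1) = 1 := by
    have := apply_neg_one_sq (E * χ)
    simp only [MulChar.mul_apply, hneg] at this ⊢
    linear_combination this
  have hs := apply_neg_one_sq χ
  rw [i1, hneg] at j
  rw [i3, hsA, one_mul] at j'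
  rw [i2] at k
  rw [hneg, one_mul] at rκ
  have hq : (Fintype.card F : ℂ) ≠ 0 := card_ne_zero_complex
  have hφ0 := gaussSum_ne_zero (phi F) hψ
  apply mul_left_cancel₀ (mul_ne_zero (mul_ne_zero hq hq) hφ0)
  set q := (Fintype.card F : ℂ)
  set J := jacobiSum χ κ
  set J' := jacobiSum (E * κ * χ) (E * κ * κ * χ)
  set K := kernelTransform E κ χ
  set D4 := (κ * χ⁻¹) 4
  set C4 := (E * χ) 4
  set Gφ := gaussSum (phi F) ψ
  set GA := gaussSum (E * κ * χ) ψ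
  set GA' := gaussSum (E * κ * κ * χ) ψ
  set Gχ := gaussSum χ ψ
  set Gχ' := gaussSum χ⁻¹ ψ
  set Gκ := gaussSum κ ψ
  set Gκ' := gaussSum κ⁻¹ ψ
  set GD := gaussSum (κ * χ⁻¹) ψ
  set GD' := gaussSum (κ * χ⁻¹ * phi F) ψ
  set GDD := gaussSum (κ * χ⁻¹ * (κ * χ⁻¹)) ψ
  set s := χ (-1)
  linear_combination q * J * D4 * k + s * C4 * GA * Gκ' * GD * Gχ' * GA' * D4 * j +
    s * s * C4 * GA * Gκ' * Gχ' * GA' * Gχ * Gκ * d +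
      C4 * GA * Gκ' * Gχ' * GA' * Gχ * Gκ * GDD * Gφ * hs
    + C4 * GA * Gχ' * GA' * Gχ * GDD * Gφ * rκ - q * Gφ * C4 * Gχ * Gχ' * j'

/-- Sum over the two solutions `u` of `-32 u (1 - u) = M`. -/
noncomputable def dihedralSum (A B : MulChar F ℂ) (M : F) : ℂ :=
  ∑ u : F, if -32 * (u * (1 - u)) = M then A u * B (1 - u) else 0

theorem mellin_dihedralSum (A B χ : MulChar F ℂ) :
    ∑ M : F, χ M * dihedralSum A B M = χ (-32) * jacobiSum (A * χ) (B * χ) := by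
  simp_rw [dihedralSum, Finset.mul_sum]
  rw [Finset.sum_comm, jacobiSum, Finset.mul_sum]
  refine Finset.sum_congr rfl fun u _ => ?_
  simp only [mul_ite, mul_zero, Finset.sum_ite_eq, Finset.mem_univ, if_true, MulChar.mul_apply,
    map_mul]
  ring

/-- The two Mellin transforms agree. The subtracted constant is seen only by χ = 1, where it reduces
the factor q to q − (q − 1) = 1. -/
theorem factoredSum_eq (h2 : (2 : F) ≠ 0) {E κ : MulChar F ℂ}
    (hκ : κ * κ = phi F) (hκ1 : κ ≠ 1) (hE : E * E * κ = 1) (hneg : κ (-1) = 1)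
    {M : F} (hM : M ≠ 0) :
    factoredSum E κ M = phi F 2 * (Fintype.card F * dihedralSum (E * κ) (E * κ * κ) M -
      jacobiSum (E * κ) (E * κ * κ)) := by
  classical
  refine eq_of_forall_mellin_eq (f := factoredSum E κ) (g := fun M => phi F 2 *
    (Fintype.card F * dihedralSum (E * κ) (E * κ * κ) M - jacobiSum (E * κ) (E * κ * κ)))
    (fun χ => ?_) hM
  have h4 : (4 : F) = 2 * 2 := by norm_num
  have h40 : (4 : F) ≠ 0 := h4 ▸ mul_ne_zero h2 h2
  have hJK := jacobiSum_mul_kernelTransform h2 hκ hκ1 hE hneg χ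
  have e1 : ∑ M : F, χ M * (phi F 2 *
      (Fintype.card F * dihedralSum (E * κ) (E * κ * κ) M - jacobiSum (E * κ) (E * κ * κ))) =
      phi F 2 * (Fintype.card F * ∑ M : F, χ M * dihedralSum (E * κ) (E * κ * κ) M -
        (∑ M : F, χ M) * jacobiSum (E * κ) (E * κ * κ)) := by
    rw [Finset.mul_sum, Finset.sum_mul, ← Finset.sum_sub_distrib, Finset.mul_sum]
    exact Finset.sum_congr rfl fun M _ => by ring
  rw [e1, mellin_dihedralSum, mellin_factoredSum h2 hneg, sum_mulChar]
  have a1 : (κ * χ⁻¹) 4 * (κ 4 * χ 4 * χ 4 ) = κ 4 * κ 4 * χ 4 := by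
    have : χ⁻¹ 4 * χ 4 = 1 := by
      rw [MulChar.inv_apply', ← map_mul, inv_mul_cancel₀ h40, map_one]
    rw [MulChar.mul_apply]
    linear_combination (κ 4 * κ 4 * χ 4) * this
  have a2 : E 2 * E 2 * κ 2 = 1 := by
    rw [← MulChar.mul_apply, ← MulChar.mul_apply, hE,
      MulChar.one_apply (isUnit_iff_ne_zero.mpr h2)]
  have a3 : κ 4 * κ 4 = 1 := by
    rw [← MulChar.mul_apply, hκ, h4, map_mul, phi_sq h2]
  have a4 : phi F 2 = κ 2 * κ 2 := by rw [← hκ, MulChar.mul_apply]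
  have a5 : κ 4 = κ 2 * κ 2 := by rw [h4, map_mul]
  have a6 : E 4 = E 2 * E 2 := by rw [h4, map_mul]
  -- The −32 in `dihedralSum`: −2 comes from the linear factor 2r + Ms, and each duplication
  -- contributes a 4.
  have a7 : χ (-32) = χ (-2) * (χ 4 * χ 4) := by rw [← map_mul, ← map_mul]; norm_num
  have hχ4 : χ 4 ≠ 0 := by
    rw [MulChar.apply_ne_zero_iff]; exact isUnit_iff_ne_zero.mpr h40
  have b1 : jacobiSum χ κ * kernelTransform E κ χ = κ 4 * χ 4 * ((E * χ) 4 *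
      jacobiSum (E * κ * χ) (E * κ * κ * χ) * if χ = 1 then 1 else χ (-1) * Fintype.card F) := by
    rw [← hJK]
    apply mul_left_cancel₀ hχ4
    linear_combination (-(jacobiSum χ κ * kernelTransform E κ χ)) * (a1 + χ 4 * a3)
  have b2 : χ (-2) * κ 2 * jacobiSum χ κ * (χ (-1) * kernelTransform E κ χ) =
      χ (-32) * phi F 2 * jacobiSum (E * κ * χ) (E * κ * κ * χ) *
        (χ (-1) * if χ = 1 then 1 else χ (-1) * Fintype.card F) := by
    rw [MulChar.mul_apply, a6, a5] at b1
    rw [a7, a4]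
    linear_combination χ (-2) * κ 2 * χ (-1) * b1 + χ (-2) * χ (-1) * κ 2 * κ 2 * (χ 4 * χ 4 *
      jacobiSum (E * κ * χ) (E * κ * κ * χ) * if χ = 1 then 1 else χ (-1) * Fintype.card F) * a2
  rw [b2]
  split_ifs with h
  · have h32 : (-32 : F) ≠ 0 := by
      have : (-32 : F) = -(2 * 2 * 2 * 2 * 2) := by norm_num
      rw [this]
      exact neg_ne_zero.mpr (by simp only [mul_ne_zero_iff]; tauto)
    rw [h, MulChar.one_apply (isUnit_iff_ne_zero.mpr h32),
      MulChar.one_apply (isUnit_iff_ne_zero.mpr (neg_ne_zero.mpr one_ne_zero)), mul_one, mul_one]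
    ring
  · linear_combination χ (-32) * phi F 2 * jacobiSum (E * κ * χ) (E * κ * κ * χ) *
      Fintype.card F * apply_neg_one_sq χ

end Transform

/-- In additive notation, identities between monomials in η and χ become integer linear algebra
modulo this relation. -/
theorem ofMul_eq_zero {F : Type*} [Field F] {η : MulChar F ℂ} (hη : η ^ 24 = 1) :
    (24 : ℤ) • Additive.ofMul η = 0 := by
  have := congrArg Additive.ofMul hη
  rw [ofMul_pow, ofMul_one] at this
  exact_mod_cast this

/-! ### The period function and the exponential sum. -/

section Period

variable {F : Type*} [Field F] [Fintype F]

theorem sum_mul_comp_mul (A : MulChar F ℂ) (f : F → ℂ) {c : F} (hc : c ≠ 0) :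
    ∑ x : F, A x * f (c * x) = A⁻¹ c * ∑ x : F, A x * f x := by
  rw [← sum_comp_affine hc 0 fun x => A x * f x, Finset.mul_sum]
  refine Finset.sum_congr rfl fun x _ => ?_
  have : A⁻¹ c * A c = 1 := by
    rw [MulChar.inv_apply', ← map_mul, inv_mul_cancel₀ hc, map_one]
  rw [zero_add, map_mul]
  linear_combination -(A x * f (c * x)) * this

theorem sum_mul_addChar (A : MulChar F ℂ) (ψ : AddChar F ℂ) {c : F} (hc : c ≠ 0) :
    ∑ x : F, A x * ψ (c * x) = A⁻¹ c * gaussSum A ψ :=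
  sum_mul_comp_mul A ψ hc

theorem mellin_period21 (A₁ A₂ B₁ χ : MulChar F ℂ) :
    ∑ l : F, χ l * period21 A₁ A₂ B₁ l =
      jacobiSum χ A₁⁻¹ * jacobiSum (A₂ * χ⁻¹) (A₂⁻¹ * B₁) := by
  simp_rw [period21, Finset.mul_sum]
  rw [Finset.sum_comm, jacobiSum, jacobiSum, Finset.mul_sum]
  refine Finset.sum_congr rfl fun y _ => ?_
  rcases eq_or_ne y 0 with rfl | hy
  · simp [MulChar.map_zero]
  have h := sum_mul_comp_mul χ (fun z => A₁⁻¹ (1 - z)) hy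
  rw [MulChar.mul_apply A₂ χ⁻¹, mul_comm (∑ x : F, χ x * A₁⁻¹ (1 - x))]
  rw [Finset.sum_congr rfl (g := fun l => A₂ y * (A₂⁻¹ * B₁) (1 - y) *
    (χ l * A₁⁻¹ (1 - y * l))) fun l _ => by rw [mul_comm y l]; ring, ← Finset.mul_sum, h]
  ring

/-- A three-dimensional exponential sum whose Mellin transform is a product of four Gauss sums. -/
noncomputable def exponentialSum (A E κ : MulChar F ℂ) (ψ : AddChar F ℂ) (θ : F) : ℂ :=
  ∑ z : F, ∑ a : F, ∑ b : F, A z * E a * κ b * ψ (z + a + b + θ * z ^ 3 / (a * b))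

theorem mellin_exponentialSum (A E κ χ : MulChar F ℂ) (ψ : AddChar F ℂ) :
    ∑ θ : F, χ θ * exponentialSum A E κ ψ θ =
      gaussSum (A * (χ ^ 3)⁻¹) ψ * (gaussSum (E * χ) ψ * (gaussSum (κ * χ) ψ * gaussSum χ ψ)) := by
  simp_rw [exponentialSum, Finset.mul_sum]
  rw [Finset.sum_comm, gaussSum, Finset.sum_mul]
  refine Finset.sum_congr rfl fun z _ => ?_
  rw [Finset.sum_comm, gaussSum, Finset.sum_mul, Finset.mul_sum]
  refine Finset.sum_congr rfl fun a _ => ?_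
  rw [Finset.sum_comm, gaussSum, Finset.sum_mul, Finset.mul_sum, Finset.mul_sum]
  refine Finset.sum_congr rfl fun b _ => ?_
  rcases eq_or_ne z 0 with rfl | hz
  · simp [MulChar.map_zero]
  rcases eq_or_ne a 0 with rfl | ha
  · simp [MulChar.map_zero]
  rcases eq_or_ne b 0 with rfl | hb
  · simp [MulChar.map_zero]
  have hc : z ^ 3 / (a * b) ≠ 0 := div_ne_zero (pow_ne_zero 3 hz) (mul_ne_zero ha hb)
  have h := sum_mul_addChar χ ψ hc
  have hχ : χ⁻¹ (z ^ 3 / (a * b)) = (χ ^ 3)⁻¹ z * (χ a * χ b) := by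
    rw [MulChar.inv_apply', MulChar.inv_apply', inv_div, div_eq_mul_inv, map_mul, map_mul,
      MulChar.pow_apply' _ (by norm_num), ← map_pow, inv_pow]
    ring
  rw [hχ] at h
  rw [Finset.sum_congr rfl (g := fun θ => A z * E a * κ b * (ψ z * ψ a * ψ b) *
    (χ θ * ψ (z ^ 3 / (a * b) * θ))) fun θ _ => by
      rw [AddChar.map_add_eq_mul, AddChar.map_add_eq_mul, AddChar.map_add_eq_mul,
        show θ * z ^ 3 / (a * b) = z ^ 3 / (a * b) * θ by ring]
      ring, ← Finset.mul_sum, h, MulChar.mul_apply, MulChar.mul_apply, MulChar.mul_apply]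
  ring

variable [DecidableEq F]

theorem sum_phi_mul_addChar (h2 : (2 : F) ≠ 0) (ψ : AddChar F ℂ) (v : F) :
    ∑ z : F, phi F z * ψ (v * z) = phi F v * gaussSum (phi F) ψ := by
  rcases eq_or_ne v 0 with rfl | hv
  · simp [MulChar.map_zero, MulChar.sum_eq_zero_of_ne_one (phi_ne_one h2)]
  · rw [sum_mul_addChar _ _ hv, inv_eq_of_mul_eq_one_left (phi_mul_phi (F := F))]

/-- Replacing z by dz absorbs the cube d³, and scaling a, b by z makes the phase linear in z. As AEκ
= φ, the z-sum is then a quadratic Gauss sum. -/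
theorem exponentialSum_eq (h2 : (2 : F) ≠ 0) {A E κ : MulChar F ℂ} (hA : A * E * κ = phi F)
    (ψ : AddChar F ℂ) {x : F} (hd : 1 - 4 * x ≠ 0) :
    exponentialSum A E κ ψ (x / (1 - 4 * x) ^ 3) =
      A (1 - 4 * x) * gaussSum (phi F) ψ *
        ((E * κ) (-1 / 2) * phi F (1 / 2) * surfaceSum E κ (-8 * x)) := by
  set d := 1 - 4 * x with hd'
  have e1 : exponentialSum A E κ ψ (x / d ^ 3) = A d * ∑ z : F, ∑ a : F, ∑ b : F,
      phi F z * (E a * κ b) * ψ ((d + a + b + x / (a * b)) * z) := by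
    rw [exponentialSum, ← sum_comp_affine hd 0, Finset.mul_sum]
    refine Finset.sum_congr rfl fun z _ => ?_
    rcases eq_or_ne z 0 with rfl | hz
    · simp [MulChar.map_zero]
    rw [← sum_comp_affine hz 0, Finset.mul_sum]
    refine Finset.sum_congr rfl fun a _ => ?_
    rcases eq_or_ne a 0 with rfl | ha
    · simp [MulChar.map_zero]
    rw [← sum_comp_affine hz 0, Finset.mul_sum]
    refine Finset.sum_congr rfl fun b _ => ?_
    rcases eq_or_ne b 0 with rfl | hb
    · simp [MulChar.map_zero]
    have t : 0 + d * z + (0 + z * a) + (0 + z * b) +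
        x / d ^ 3 * (0 + d * z) ^ 3 / ((0 + z * a) * (0 + z * b)) =
        (d + a + b + x / (a * b)) * z := by
      field_simp; ring
    rw [t, ← hA, zero_add, zero_add, zero_add, map_mul, map_mul, map_mul, MulChar.mul_apply,
      MulChar.mul_apply]
    ring
  have e2 : ∑ z : F, ∑ a : F, ∑ b : F,
      phi F z * (E a * κ b) * ψ ((d + a + b + x / (a * b)) * z) =
      gaussSum (phi F) ψ * ∑ a : F, ∑ b : F, E a * κ b * phi F (d + a + b + x / (a * b)) := by
    rw [Finset.sum_comm, Finset.mul_sum]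
    refine Finset.sum_congr rfl fun a _ => ?_
    rw [Finset.sum_comm, Finset.mul_sum]
    refine Finset.sum_congr rfl fun b _ => ?_
    have h := sum_phi_mul_addChar h2 ψ (d + a + b + x / (a * b))
    rw [Finset.sum_congr rfl (g := fun z => E a * κ b *
      (phi F z * ψ ((d + a + b + x / (a * b)) * z))) fun z _ => by ring, ← Finset.mul_sum, h]
    ring
  -- Scaling a and b by −1/2 and extracting 1/2 turns the constant 1 − 4x into 2 + M with M = −8x.
  have hhalf : (-1 / 2 : F) ≠ 0 := div_ne_zero (neg_ne_zero.mpr one_ne_zero) h2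
  have e3 : ∑ a : F, ∑ b : F, E a * κ b * phi F (d + a + b + x / (a * b)) =
      (E * κ) (-1 / 2) * phi F (1 / 2) * surfaceSum E κ (-8 * x) := by
    rw [surfaceSum, ← sum_comp_affine hhalf 0, Finset.mul_sum]
    refine Finset.sum_congr rfl fun a _ => ?_
    rcases eq_or_ne a 0 with rfl | ha
    · simp [MulChar.map_zero]
    rw [← sum_comp_affine hhalf 0, Finset.mul_sum]
    refine Finset.sum_congr rfl fun b _ => ?_
    rcases eq_or_ne b 0 with rfl | hb
    · simp [MulChar.map_zero]
    have t : d + (0 + -1 / 2 * a) + (0 + -1 / 2 * b) +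
        x / ((0 + -1 / 2 * a) * (0 + -1 / 2 * b)) =
        1 / 2 * (2 + -8 * x - a - b - -8 * x / (a * b)) := by
      have t1 : x / ((0 + -1 / 2 * a) * (0 + -1 / 2 * b)) = 2 * 2 * (x / (a * b)) := by
        rw [zero_add, zero_add, div_mul_eq_mul_div (-1) 2 a, div_mul_eq_mul_div (-1) 2 b,
          div_mul_div_comm,
          neg_one_mul, neg_one_mul, neg_mul_neg, div_div_eq_mul_div, mul_comm x, mul_div_assoc]
      rw [t1, hd', mul_div_assoc]
      generalize x / (a * b) = y
      field_simp; ring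
    rw [t, zero_add, zero_add, map_mul, map_mul, map_mul, MulChar.mul_apply]
    ring
  rw [e1, e2, e3]; ring

end Period

/-! ### The cubic transformation for characters of order 24. -/

section Order24

variable {F : Type*} [Field F] [Fintype F] [DecidableEq F]

/-- The cubic transformation at the level of exponential sums. -/
theorem period21_eq_exponentialSum {η : MulChar F ℂ} (hη : orderOf η = 24)
    (hcube : ∀ w : Fˣ, (η ^ 8) w = 1 → ∃ u : Fˣ, u ^ 3 = w) {ω : F} (hω : ω ^ 2 + ω + 1 = 0)
    (h2 : (2 : F) ≠ 0) (h3 : (3 : F) ≠ 0) {ψ : AddChar F ℂ} (hψ : ψ.IsPrimitive)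
    {θ : F} (hθ : θ ≠ 0) :
    (Fintype.card F : ℂ) ^ 2 * (η ^ 15) (-27) * period21 η⁻¹ (η ^ 7) (η ^ 18) (-27 * θ) =
      η (-1) * gaussSum η ψ * gaussSum (η ^ 11) ψ *
        (exponentialSum (η ^ 3)⁻¹ (η ^ 9) (η ^ 6) ψ θ +
          gaussSum (η ^ 15) ψ * gaussSum (η ^ 21) ψ * (η ^ 9) θ) := by
  classical
  have h24 : η ^ 24 = 1 := hη ▸ pow_orderOf_eq_one η
  have hne : ∀ k : ℕ, k ≠ 0 → k < 24 → η ^ k ≠ 1 := fun k hk hk' =>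
    pow_ne_one_of_lt_orderOf hk (hη ▸ hk')
  have h24' := ofMul_eq_zero h24
  have h27 : (-27 : F) ≠ 0 := by
    have : (-27 : F) = -(3 * 3 * 3) := by norm_num
    rw [this]; exact neg_ne_zero.mpr (mul_ne_zero (mul_ne_zero h3 h3) h3)
  refine eq_of_forall_mellin_eq
    (f := fun θ => (Fintype.card F : ℂ) ^ 2 * (η ^ 15) (-27) *
      period21 η⁻¹ (η ^ 7) (η ^ 18) (-27 * θ))
    (g := fun θ => η (-1) * gaussSum η ψ * gaussSum (η ^ 11) ψ *
      (exponentialSum (η ^ 3)⁻¹ (η ^ 9) (η ^ 6) ψ θ +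
        gaussSum (η ^ 15) ψ * gaussSum (η ^ 21) ψ * (η ^ 9) θ)) (fun χ => ?_) hθ
  have hη1 : η ≠ 1 := by simpa using hne 1 (by norm_num) (by norm_num)
  have i1 : (χ * η)⁻¹ = η ^ 8 * (η ^ 15 * χ⁻¹) := by
    apply Additive.ofMul.injective
    simp only [ofMul_mul, ofMul_inv, ofMul_pow]
    linear_combination (norm := module) (-1 : ℤ) • h24'
  have i2 : η ^ 7 * χ⁻¹ = (η ^ 8) ^ 2 * (η ^ 15 * χ⁻¹) := by
    apply Additive.ofMul.injective
    simp only [ofMul_mul, ofMul_inv, ofMul_pow]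
    linear_combination (norm := module) (-1 : ℤ) • h24'
  have i3 : (η ^ 7)⁻¹ * η ^ 18 = η ^ 11 := by
    rw [inv_mul_eq_iff_eq_mul, ← pow_add]
  have i4 : (η ^ 7 * χ⁻¹ * η ^ 11)⁻¹ = η ^ 6 * χ := by
    apply Additive.ofMul.injective
    simp only [ofMul_mul, ofMul_inv, ofMul_pow]
    linear_combination (norm := module) (-1 : ℤ) • h24'
  have i5 : (η ^ 15 * χ⁻¹)⁻¹ = η ^ 9 * χ := by
    apply Additive.ofMul.injective
    simp only [ofMul_mul, ofMul_inv, ofMul_pow]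
    linear_combination (norm := module) (-1 : ℤ) • h24'
  have i6 : (η ^ 15 * χ⁻¹) ^ 3 = (η ^ 3)⁻¹ * (χ ^ 3)⁻¹ := by
    apply Additive.ofMul.injective
    simp only [ofMul_mul, ofMul_inv, ofMul_pow]
    linear_combination (norm := module) (2 : ℤ) • h24'
  have hρ : (η ^ 8) ^ 3 = 1 := by rw [← pow_mul]; exact h24
  have j1 := card_mul_jacobiSum (A := χ) (B := η) (fun h => hη1 h.2) hψ
  have j2 := card_mul_jacobiSum (A := η ^ 7 * χ⁻¹) (B := η ^ 11)
    (fun h => hne 11 (by norm_num) (by norm_num) h.2) hψ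
  rw [i4] at j2
  have s1 := apply_neg_one_sq η
  have s2 := apply_neg_one_sq χ
  have hpow : ∀ k : ℕ, k ≠ 0 → ∀ y : F, (η ^ k) y = η y ^ k := fun k hk y =>
    MulChar.pow_apply' η hk y
  have hsign : χ (-1) * η (-1) * ((η ^ 7 * χ⁻¹) (-1) * (η ^ 11) (-1)) = η (-1) := by
    rw [MulChar.mul_apply, inv_apply_neg_one, hpow 7 (by norm_num), hpow 11 (by norm_num)]
    have : η (-1) ^ 18 = 1 := by
      rw [show 18 = 2 * 9 from rfl, pow_mul, sq, s1, one_pow]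
    linear_combination (η (-1) ^ 19) * s2 + η (-1) * this
  -- Triplication with β = η¹⁵χ⁻¹. At β = 1 the left side is G(η⁸)G(η¹⁶) = q while G(1)² = 1, so q −
  -- 1 must be added; this is the transform of the η⁹(θ) term.
  have hd : (η ^ 15) (-27) * (χ⁻¹ (-27) * (gaussSum (χ * η)⁻¹ ψ * gaussSum (η ^ 7 * χ⁻¹) ψ)) =
      gaussSum (η ^ 9 * χ) ψ * gaussSum ((η ^ 3)⁻¹ * (χ ^ 3)⁻¹) ψ +
        if χ * η ^ 9 = 1 then (Fintype.card F : ℂ) - 1 else 0 := by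
    by_cases hβ : η ^ 15 * χ⁻¹ = 1
    · have hχ : χ = η ^ 15 := (mul_inv_eq_one.mp hβ).symm
      have hβ' : χ * η ^ 9 = 1 := by rw [hχ, ← pow_add]; exact h24
      rw [if_pos hβ', ← i5, ← i6, i1, i2, ← mul_assoc, ← MulChar.mul_apply, hβ, inv_one, one_pow,
        gaussSum_one hψ, mul_one, mul_one, MulChar.one_apply (isUnit_iff_ne_zero.mpr h27)]
      have r := gaussSum_mul_gaussSum_inv (hne 8 (by norm_num) (by norm_num)) hψ
      have : (η ^ 8)⁻¹ = (η ^ 8) ^ 2 := by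
        rw [inv_eq_iff_mul_eq_one, ← pow_succ', hρ]
      rw [this, MulChar.val_neg_one_eq_one_of_odd_order (by decide) hρ] at r
      linear_combination r
    · have hβ' : χ * η ^ 9 ≠ 1 := fun h => hβ (by
        rw [← inv_inj, i5, mul_comm, h, inv_one])
      rw [if_neg hβ', add_zero, i1, i2, ← mul_assoc, ← MulChar.mul_apply,
        gaussSum_triplication hρ hcube hω h2 h3 hβ hψ, i5, i6]
  have e1 : ∑ θ : F, χ θ * ((Fintype.card F : ℂ) ^ 2 * (η ^ 15) (-27) *
      period21 η⁻¹ (η ^ 7) (η ^ 18) (-27 * θ)) = (Fintype.card F : ℂ) ^ 2 * (η ^ 15) (-27) *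
      (χ⁻¹ (-27) * (jacobiSum χ η * jacobiSum (η ^ 7 * χ⁻¹) (η ^ 11))) := by
    have h := mellin_period21 η⁻¹ (η ^ 7) (η ^ 18) χ
    rw [inv_inv, i3] at h
    rw [← h, ← sum_mul_comp_mul χ _ h27, Finset.mul_sum]
    exact Finset.sum_congr rfl fun θ _ => by ring
  have e2 : ∑ θ : F, χ θ * (η (-1) * gaussSum η ψ * gaussSum (η ^ 11) ψ *
      (exponentialSum (η ^ 3)⁻¹ (η ^ 9) (η ^ 6) ψ θ +
        gaussSum (η ^ 15) ψ * gaussSum (η ^ 21) ψ * (η ^ 9) θ)) =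
      η (-1) * gaussSum η ψ * gaussSum (η ^ 11) ψ *
        (∑ θ : F, χ θ * exponentialSum (η ^ 3)⁻¹ (η ^ 9) (η ^ 6) ψ θ +
          gaussSum (η ^ 15) ψ * gaussSum (η ^ 21) ψ * ∑ θ : F, (χ * η ^ 9) θ) := by
    rw [Finset.mul_sum (a := gaussSum (η ^ 15) ψ * _), ← Finset.sum_add_distrib, Finset.mul_sum]
    exact Finset.sum_congr rfl fun θ _ => by rw [MulChar.mul_apply]; ring
  rw [e1, e2, mellin_exponentialSum, sum_mulChar]
  have key : (Fintype.card F : ℂ) ^ 2 * (jacobiSum χ η * jacobiSum (η ^ 7 * χ⁻¹) (η ^ 11)) =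
      η (-1) * (gaussSum χ ψ * gaussSum η ψ * gaussSum (χ * η)⁻¹ ψ) *
        (gaussSum (η ^ 7 * χ⁻¹) ψ * gaussSum (η ^ 11) ψ * gaussSum (η ^ 6 * χ) ψ) := by
    rw [← hsign]
    calc _ = (Fintype.card F * jacobiSum χ η) *
          (Fintype.card F * jacobiSum (η ^ 7 * χ⁻¹) (η ^ 11)) := by ring
      _ = _ := by rw [j1, j2]; ring
  have hfin : gaussSum χ ψ * gaussSum (η ^ 6 * χ) ψ *
      (if χ * η ^ 9 = 1 then (Fintype.card F : ℂ) - 1 else 0) =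
      gaussSum (η ^ 15) ψ * gaussSum (η ^ 21) ψ *
        if χ * η ^ 9 = 1 then (Fintype.card F : ℂ) - 1 else 0 := by
    split_ifs with h
    · have hχ : χ = η ^ 15 := by
        rw [eq_inv_of_mul_eq_one_left h, inv_eq_iff_mul_eq_one, ← pow_add]; exact h24
      rw [hχ, ← pow_add]
    · ring
  linear_combination (η ^ 15) (-27) * χ⁻¹ (-27) * key + η (-1) * gaussSum η ψ *
    gaussSum (η ^ 11) ψ * (gaussSum χ ψ * gaussSum (η ^ 6 * χ) ψ * hd + hfin)

end Order24

/-! ### Evaluation of the constants and of the dihedral sum. -/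

section Evaluation

variable {F : Type*} [Field F] [Fintype F]

/-- An element at which a character of order `n` takes the value `1` is an `n`-th power. -/
theorem exists_pow_eq_of_apply_eq_one {χ : MulChar F ℂ} {w : Fˣ} (hw : χ w = 1) :
    ∃ u : Fˣ, u ^ orderOf χ = w := by
  obtain ⟨g, hg⟩ := IsCyclic.exists_generator (α := Fˣ)
  obtain ⟨k, rfl⟩ := Subgroup.mem_zpowers_iff.mp (hg w)
  have hord : orderOf (χ.toUnitHom g) = orderOf χ := by
    refine orderOf_eq_orderOf_iff.mpr fun n => ?_
    rw [Units.ext_iff, Units.val_pow_eq_pow_val, MulChar.coe_toUnitHom, Units.val_one,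
      ← MulChar.pow_apply_coe]
    constructor
    · intro h
      refine (MulChar.eq_iff hg _ _).mpr ?_
      rw [h, MulChar.one_apply_coe]
    · intro h; rw [h, MulChar.one_apply_coe]
  have hk : χ.toUnitHom g ^ k = 1 := by
    rw [← map_zpow, Units.ext_iff, MulChar.coe_toUnitHom, hw, Units.val_one]
  rw [← orderOf_dvd_iff_zpow_eq_one, hord] at hk
  obtain ⟨j, rfl⟩ := hk
  exact ⟨g ^ j, by rw [mul_comm, zpow_mul, zpow_natCast]⟩

variable [DecidableEq F]

theorem exists_primitive_cube_root (hq : 3 ∣ Fintype.card F - 1) :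
    ∃ ω : F, ω ^ 2 + ω + 1 = 0 := by
  obtain ⟨z, hz⟩ : ∃ z : Fˣ, orderOf z = 3 := by
    have : Fact (Nat.Prime 3) := ⟨Nat.prime_three⟩
    exact exists_prime_orderOf_dvd_card 3 (by rwa [Fintype.card_units])
  refine ⟨z, ?_⟩
  have h1 : (z : F) ^ 3 = 1 := by
    rw [← Units.val_pow_eq_pow_val, ← hz, pow_orderOf_eq_one, Units.val_one]
  have h2 : (z : F) ≠ 1 := by
    intro h
    rw [Units.val_eq_one] at h
    rw [h, orderOf_one] at hz
    norm_num at hz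
  apply mul_left_cancel₀ (sub_ne_zero.mpr h2)
  linear_combination h1

theorem pow_twelve_eq_phi {η : MulChar F ℂ} (hη : orderOf η = 24) : η ^ 12 = phi F := by
  refine eq_phi_of_mul_self_eq_one ?_ (pow_ne_one_of_lt_orderOf (by norm_num)
    (by rw [hη]; norm_num))
  rw [← pow_add]
  exact (hη ▸ pow_orderOf_eq_one η : η ^ 24 = 1)

/-- The sum of `A (1 - u)` over the solutions of `4 u (1 - u) = x` in terms of a square root of
`1 - x`. -/
theorem sum_dihedral_eq (h2 : (2 : F) ≠ 0) {A B : MulChar F ℂ} (hB : B * B = A)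
    {x s d : F} (hs : IsSquare (1 - x) → s ^ 2 = 1 - x) :
    B⁻¹ d * ∑ u : F, (if 4 * (u * (1 - u)) = x then A (1 - u) else 0) =
      (1 + phi F (1 - x)) / 2 *
        (B ((1 + s) ^ 2 / (2 ^ 2 * d)) + B ((1 - s) ^ 2 / (2 ^ 2 * d))) := by
  have hhalf : (2⁻¹ : F) ≠ 0 := inv_ne_zero h2
  have hval : ∀ y : F, B (y ^ 2 / (2 ^ 2 * d)) = B⁻¹ d * A (y / 2) := by
    intro y
    rw [← hB, MulChar.mul_apply, ← map_mul, MulChar.inv_apply', ← map_mul]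
    congr 1; rw [div_mul_div_comm, ← sq, ← sq, ← div_div, div_eq_inv_mul]
  have e1 : ∑ u : F, (if 4 * (u * (1 - u)) = x then A (1 - u) else 0) =
      ∑ t : F, if t ^ 2 = 1 - x then A ((1 + t) / 2) else 0 := by
    rw [← sum_comp_affine (neg_ne_zero.mpr hhalf) 2⁻¹]
    refine Finset.sum_congr rfl fun t _ => ?_
    have t1 : 4 * ((2⁻¹ + -2⁻¹ * t) * (1 - (2⁻¹ + -2⁻¹ * t))) = 1 - t ^ 2 := by
      have : (2 : F) * 2⁻¹ = 1 := mul_inv_cancel₀ h2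
      linear_combination (2 * (1 - t) - (1 - t) ^ 2 * (2 * 2⁻¹ + 1)) * this
    have t2 : 1 - (2⁻¹ + -2⁻¹ * t) = (1 + t) / 2 := by
      field_simp; ring
    rw [t1, t2]
    refine if_congr ⟨fun h => by linear_combination -h, fun h => by linear_combination -h⟩ rfl rfl
  rw [e1, hval, hval]
  by_cases hsq : IsSquare (1 - x)
  · have hs := hs hsq
    rw [← hs]
    -- Double root: φ(0) = 0, so the factor 1/2 reduces the two equal terms to the single one.
    by_cases hs0 : s = 0
    · rw [hs0]
      simp only [ne_eq, OfNat.ofNat_ne_zero, not_false_eq_true, zero_pow, MulChar.map_zero,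
        pow_eq_zero_iff, Finset.sum_ite_eq', Finset.mem_univ, if_true, sub_zero, add_zero]
      ring
    · rw [phi_one_of_square hs0]
      have hne : s ≠ -s := fun h => by
        have : (2 : F) * s = 0 := by linear_combination h
        exact mul_ne_zero h2 hs0 this
      rw [← Finset.sum_filter]
      have : (Finset.univ.filter fun t : F => t ^ 2 = s ^ 2) = {s, -s} := by
        ext t
        simp [sq_eq_sq_iff_eq_or_eq_neg]
      rw [this, Finset.sum_pair hne]
      rw [← sub_eq_add_neg]; ring
  · rw [phi_neg_one_iff.mpr hsq]
    have : ∀ t : F, (if t ^ 2 = 1 - x then A ((1 + t) / 2) else 0) = 0 := by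
      intro t
      rw [if_neg]
      intro h
      exact hsq ⟨t, by rw [← h, sq]⟩
    simp [this]

/-- A relation between Gauss sums of characters of order dividing `24`. -/
theorem gaussSum_relation {η : MulChar F ℂ} (hη : orderOf η = 24)
    (hcube : ∀ w : Fˣ, (η ^ 8) w = 1 → ∃ u : Fˣ, u ^ 3 = w) {ω : F} (hω : ω ^ 2 + ω + 1 = 0)
    (h2 : (2 : F) ≠ 0) (h3 : (3 : F) ≠ 0) {ψ : AddChar F ℂ} (hψ : ψ.IsPrimitive) :
    (η ^ 9) (-27) * (η ^ 3) 4 * η (-1) * (gaussSum η ψ * gaussSum (phi F) ψ) * phi F (-1) =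
      gaussSum (η ^ 6) ψ * gaussSum (η ^ 7) ψ := by
  have h24 : η ^ 24 = 1 := hη ▸ pow_orderOf_eq_one η
  have hne : ∀ k : ℕ, k ≠ 0 → k < 24 → η ^ k ≠ 1 := fun k hk hk' =>
    pow_ne_one_of_lt_orderOf hk (hη ▸ hk')
  have hφ := pow_twelve_eq_phi hη
  have hinv : ∀ j k : ℕ, j + k = 24 → (η ^ j)⁻¹ = η ^ k := fun j k h => by
    rw [inv_eq_iff_mul_eq_one, ← pow_add, h, h24]
  -- Triplication at η⁹ and duplication at η³ share G(η³)G(η¹⁵). Eliminating it and reflecting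
  -- G(η¹⁷) and G(φ) gives the relation.
  have t := gaussSum_triplication (ρ := η ^ 8) (by rw [← pow_mul]; exact h24) hcube hω h2 h3
    (hne 9 (by norm_num) (by norm_num)) hψ
  have c1 : (η ^ 8) ^ 2 * η ^ 9 = η := by
    rw [← pow_mul, ← pow_add, show 8 * 2 + 9 = 24 + 1 from rfl, pow_add, h24, one_mul, pow_one]
  have c2 : (η ^ 9) ^ 3 = η ^ 3 := by
    rw [← pow_mul, show 9 * 3 = 24 + 3 from rfl, pow_add, h24, one_mul]
  rw [c1, c2, hinv 9 15 rfl, ← pow_add] at t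
  have d := gaussSum_duplication h2 (η ^ 3) hψ
  rw [← pow_add] at d
  have c3 : η ^ 3 * phi F = η ^ 15 := by rw [← hφ, ← pow_add]
  rw [c3] at d
  have r := gaussSum_mul_gaussSum_inv (hne 7 (by norm_num) (by norm_num)) hψ
  rw [hinv 7 17 rfl, MulChar.pow_apply' η (by norm_num)] at r
  have rφ := gaussSum_mul_gaussSum_inv (phi_ne_one (F := F) h2) hψ
  rw [inv_eq_of_mul_eq_one_left (phi_mul_phi (F := F))] at rφ
  have s1 := apply_neg_one_sq η
  have s7 : η (-1) ^ 7 = η (-1) := by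
    linear_combination (η (-1) ^ 5 + η (-1) ^ 3 + η (-1)) * s1
  rw [s7] at r
  have sφ := apply_neg_one_sq (phi F)
  have hq : (Fintype.card F : ℂ) ≠ 0 := card_ne_zero_complex
  apply mul_left_cancel₀ hq
  norm_num only at t d
  set q := (Fintype.card F : ℂ)
  set a := (η ^ 9) (-27)
  set b := (η ^ 3) 4
  set G1 := gaussSum η ψ
  set G7 := gaussSum (η ^ 7) ψ
  set G17 := gaussSum (η ^ 17) ψ
  set Gφ := gaussSum (phi F) ψ
  linear_combination -(a * b * G1 * Gφ * phi F (-1)) * r + b * G7 * Gφ * phi F (-1) * t +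
    G7 * Gφ * phi F (-1) * d + gaussSum (η ^ 6) ψ * G7 * phi F (-1) * rφ +
    gaussSum (η ^ 6) ψ * G7 * q * sφ

/-- The chain is run with A = η⁻³, E = η⁹, κ = η⁶, M = −8x. Since G(φ) J(η¹⁵, η²¹) = G(η¹⁵)G(η²¹),
the constant of `factoredSum_eq` cancels the η⁹(θ) term, and only the dihedral sum survives. -/
theorem hyp21_eq_sum {η : MulChar F ℂ} (hη : orderOf η = 24) (hφ2 : phi F 2 = 1)
    (hκneg : (η ^ 6) (-1) = 1)
    (hcube : ∀ w : Fˣ, (η ^ 8) w = 1 → ∃ u : Fˣ, u ^ 3 = w) {ω : F} (hω : ω ^ 2 + ω + 1 = 0)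
    (h2 : (2 : F) ≠ 0) (h3 : (3 : F) ≠ 0) {x : F} (hx0 : x ≠ 0) (hd : 1 - 4 * x ≠ 0)
    (hx8 : -8 * x ≠ 1) :
    period21 η⁻¹ (η ^ 7) (η ^ 18) (-27 * x / (1 - 4 * x) ^ 3) =
      jacobiSum (η ^ 7) (η ^ 11) * ((η ^ 3)⁻¹ (1 - 4 * x) *
        ∑ u : F, (if 4 * (u * (1 - u)) = x then (η ^ 6) (1 - u) else 0)) := by
  obtain ⟨ψ, hψ⟩ := exists_isPrimitive F
  have h24 : η ^ 24 = 1 := hη ▸ pow_orderOf_eq_one η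
  have hne : ∀ k : ℕ, k ≠ 0 → k < 24 → η ^ k ≠ 1 := fun k hk hk' =>
    pow_ne_one_of_lt_orderOf hk (hη ▸ hk')
  have hφ := pow_twelve_eq_phi hη
  have hpow : ∀ k : ℕ, k ≠ 0 → ∀ y : F, (η ^ k) y = η y ^ k := fun k hk y =>
    MulChar.pow_apply' η hk y
  have h24y : ∀ y : F, y ≠ 0 → η y ^ 24 = 1 := fun y hy => by
    rw [← hpow 24 (by norm_num), h24, MulChar.one_apply (isUnit_iff_ne_zero.mpr hy)]
  set d := 1 - 4 * x with hd'
  have hθ : x / d ^ 3 ≠ 0 := div_ne_zero hx0 (pow_ne_zero 3 hd)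
  have m2 : (-8 : F) ≠ 0 := by
    have : (-8 : F) = -(2 * 2 * 2) := by norm_num
    rw [this]; exact neg_ne_zero.mpr (mul_ne_zero (mul_ne_zero h2 h2) h2)
  have st := period21_eq_exponentialSum hη hcube hω h2 h3 hψ hθ
  have hA : (η ^ 3)⁻¹ * η ^ 9 * η ^ 6 = phi F := by
    rw [← hφ]
    apply Additive.ofMul.injective
    simp only [ofMul_mul, ofMul_inv, ofMul_pow]
    module
  have hκκ : η ^ 6 * η ^ 6 = phi F := by rw [← pow_add, hφ]
  have hEEκ : η ^ 9 * η ^ 9 * η ^ 6 = 1 := by rw [← pow_add, ← pow_add]; exact h24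
  rw [exponentialSum_eq h2 hA ψ hd, surfaceSum_eq h2 hκκ
      (inv_ne_one.mpr (hne 6 (by norm_num) (by norm_num))) (hne 9 (by norm_num) (by norm_num))
      hEEκ hκneg (mul_ne_zero m2 hx0) hx8,
    factoredSum_eq h2 hκκ (hne 6 (by norm_num) (by norm_num)) hEEκ hκneg (mul_ne_zero m2 hx0),
    ← pow_add, ← pow_add, ← mul_div_assoc] at st
  norm_num only at st
  have hinv : ∀ (A : MulChar F ℂ) (y : F), y ≠ 0 → A⁻¹ y * A y = 1 := fun A y hy => by
    rw [MulChar.inv_apply', ← map_mul, inv_mul_cancel₀ hy, map_one]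
  have hφ1 : phi F (1 / 2) = 1 := by
    rw [one_div, ← MulChar.inv_apply']
    simpa [hφ2] using hinv (phi F) 2 h2
  have h27 : (-27 : F) ≠ 0 := by
    have : (-27 : F) = -(3 * 3 * 3) := by norm_num
    rw [this]; exact neg_ne_zero.mpr (mul_ne_zero (mul_ne_zero h3 h3) h3)
  have h4 : (4 : F) = 2 ^ 2 := by norm_num
  have f2 := card_mul_jacobiSum (A := η ^ 7) (B := η ^ 11)
    (fun h => hne 7 (by norm_num) (by norm_num) h.1) hψ
  have c2 : (η ^ 7 * η ^ 11)⁻¹ = η ^ 6 := by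
    rw [inv_eq_iff_mul_eq_one, ← pow_add, ← pow_add]; exact h24
  have s2 : (η ^ 7) (-1) * (η ^ 11) (-1) = 1 := by
    rw [hpow 7 (by norm_num), hpow 11 (by norm_num), ← pow_add, show 7 + 11 = 2 * 9 from rfl,
      pow_mul, sq, apply_neg_one_sq, one_pow]
  rw [c2, s2, one_mul] at f2
  have f3 : (η ^ 15) (-1 / 2) * (η ^ 9) (-8 * x) = (η ^ 9) x := by
    have : (η ^ 15) (-1 / 2) * (η ^ 9) (-8 * x) = (η ^ 12) 2 * (η ^ 9) x := by
      rw [hpow 15 (by norm_num), hpow 9 (by norm_num), hpow 9 (by norm_num),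
        hpow 12 (by norm_num), ← map_pow, ← map_pow, ← map_pow, ← map_pow, ← map_mul, ← map_mul]
      congr 1; field_simp; ring
    rw [this, hφ, hφ2, one_mul]
  have f4 : (η ^ 9) (x / d ^ 3) = (η ^ 9) x * (η ^ 3)⁻¹ d := by
    have g1 : (η ^ 9) (x / d ^ 3) * (η ^ 9) (d ^ 3) = (η ^ 9) x := by
      rw [← map_mul, div_mul_cancel₀ _ (pow_ne_zero 3 hd)]
    have g2 : (η ^ 9) (d ^ 3) = (η ^ 3) d := by
      rw [hpow 9 (by norm_num), hpow 3 (by norm_num), map_pow, ← pow_mul,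
        show 3 * 9 = 24 + 3 from rfl, pow_add, h24y d hd, one_mul]
    rw [g2] at g1
    linear_combination (η ^ 3)⁻¹ d * g1 - (η ^ 9) (x / d ^ 3) * hinv (η ^ 3) d hd
  have c5 : η ^ 15 * η ^ 21 = phi F := by
    rw [← hφ, ← pow_add, show 15 + 21 = 24 + 12 from rfl, pow_add, h24, one_mul]
  have f5 := jacobiSum_mul_nontrivial (χ := η ^ 15) (φ := η ^ 21)
    (by rw [c5]; exact phi_ne_one h2) ψ
  rw [c5] at f5
  have f6 := gaussSum_relation hη hcube hω h2 h3 hψ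
  rw [← hκκ, MulChar.mul_apply, hκneg, hκκ, mul_one, mul_one] at f6
  set S := ∑ u : F, (if 4 * (u * (1 - u)) = x then (η ^ 6) (1 - u) else 0) with hS
  have f8 : (η ^ 9) 4 = (η ^ 3) 4 := by
    rw [hpow 9 (by norm_num), hpow 3 (by norm_num), h4, map_pow, ← pow_mul, ← pow_mul,
      show 2 * 9 = 12 + 2 * 3 from rfl, pow_add, ← hpow 12 (by norm_num), hφ, hφ2, one_mul]
  -- For x = 4u(1 − u), the characters of u combine to η²⁴ = 1 and those of 1 − u to η³⁰ = η⁶.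
  have f7 : (η ^ 9) x * dihedralSum (η ^ 15) (η ^ 21) (-8 * x) = (η ^ 9) 4 * S := by
    rw [dihedralSum, hS, Finset.mul_sum, Finset.mul_sum]
    refine Finset.sum_congr rfl fun u _ => ?_
    by_cases hu : 4 * (u * (1 - u)) = x
    · rw [if_pos hu, if_pos (by linear_combination -8 * hu)]
      have hu0 : u ≠ 0 := by
        rintro rfl
        exact hx0 (by rw [← hu]; ring)
      have hu1 : 1 - u ≠ 0 := by
        intro h
        exact hx0 (by rw [← hu, h]; ring)
      rw [← hu, map_mul, map_mul]
      simp only [hpow 9 (by norm_num), hpow 15 (by norm_num), hpow 21 (by norm_num),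
        hpow 6 (by norm_num)]
      linear_combination (η 4 ^ 9 * η (1 - u) ^ 30) * h24y u hu0 +
        (η 4 ^ 9 * η (1 - u) ^ 6) * h24y _ hu1
    · rw [if_neg hu, if_neg, mul_zero, mul_zero]
      intro h
      apply hu
      apply mul_left_cancel₀ m2
      linear_combination h
  have f9 : (η ^ 15) (-27) * (η ^ 9) (-27) = 1 := by
    rw [← MulChar.mul_apply, ← pow_add, show 15 + 9 = 24 from rfl, h24,
      MulChar.one_apply (isUnit_iff_ne_zero.mpr h27)]
  rw [hφ1, hφ2, f4, one_mul, mul_one] at st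
  have h15 : (η ^ 15) (-27) ≠ 0 := by
    rw [MulChar.apply_ne_zero_iff]; exact isUnit_iff_ne_zero.mpr h27
  have hq : (Fintype.card F : ℂ) ≠ 0 := card_ne_zero_complex
  apply mul_left_cancel₀ (mul_ne_zero (pow_ne_zero 2 hq) h15)
  rw [st]
  set q := (Fintype.card F : ℂ)
  set D := dihedralSum (η ^ 15) (η ^ 21) (-8 * x)
  set J' := jacobiSum (η ^ 15) (η ^ 21)
  set J := jacobiSum (η ^ 7) (η ^ 11)
  set G1 := gaussSum η ψ
  set G6 := gaussSum (η ^ 6) ψ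
  set G7 := gaussSum (η ^ 7) ψ
  set G11 := gaussSum (η ^ 11) ψ
  set G15 := gaussSum (η ^ 15) ψ
  set G21 := gaussSum (η ^ 21) ψ
  set Gφ := gaussSum (phi F) ψ
  set dd := (η ^ 3)⁻¹ d
  set e := η (-1)
  set X := (η ^ 9) x
  linear_combination e * G1 * G11 * dd * Gφ * (q * D - J') * f3 - e * G1 * G11 * dd * X * f5 +
    e * G1 * G11 * dd * Gφ * q * (f7 + S * f8) -
    q * (η ^ 15) (-27) * dd * S * (f2 - G11 * f6) -
    q * dd * S * G11 * (η ^ 3) 4 * e * G1 * Gφ * f9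

end Evaluation

end FFHyp

/-- `s` plays the role of `√(1 - x)`: it is any square root of `1 - x` when there is one in `F`,
and an arbitrary element otherwise (the factor `(1 + φ(1 - x)) / 2` is then `0`). -/
theorem mainTheorem12 {F : Type*} [Field F] [Fintype F] [DecidableEq F]
    (hq : Fintype.card F ≡ 1 [MOD 24])
    (η : MulChar F ℂ) (hη : orderOf η = 24)
    (x : F) (hx₁ : x ≠ -1 / 8) (hx₂ : x ≠ 1 / 4)
    (s : F) (hs : IsSquare (1 - x) → s ^ 2 = 1 - x) :
    FFHyp.hyp21 η⁻¹ (η ^ 7) (η ^ 18) (-27 * x / (1 - 4 * x) ^ 3) =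
      (1 + FFHyp.phi F (1 - x)) / 2 *
        ((η ^ 3) ((1 + s) ^ 2 / (2 ^ 2 * (1 - 4 * x))) +
          (η ^ 3) ((1 - s) ^ 2 / (2 ^ 2 * (1 - 4 * x)))) := by
  have hmod : Fintype.card F % 24 = 1 := hq
  have hcard : (24 : F) * ((Fintype.card F / 24 : ℕ) : F) + 1 = 0 := by
    have h : Fintype.card F = 24 * (Fintype.card F / 24) + 1 := by omega
    have h' := FiniteField.cast_card_eq_zero F
    rw [h] at h'
    exact_mod_cast h'
  have h2 : (2 : F) ≠ 0 := fun h => one_ne_zero (α := F) (by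
    linear_combination hcard - 12 * ((Fintype.card F / 24 : ℕ) : F) * h)
  have h3 : (3 : F) ≠ 0 := fun h => one_ne_zero (α := F) (by
    linear_combination hcard - 8 * ((Fintype.card F / 24 : ℕ) : F) * h)
  have hne : ∀ k : ℕ, k ≠ 0 → k < 24 → η ^ k ≠ 1 := fun k hk hk' =>
    pow_ne_one_of_lt_orderOf hk (hη ▸ hk')
  have hφ2 : FFHyp.phi F 2 = 1 := by
    have hsq : IsSquare (2 : F) := FiniteField.isSquare_two_iff.mpr (by omega)
    obtain ⟨r, hr⟩ := hsq
    have hr0 : r ≠ 0 := by rintro rfl; exact h2 (by rw [hr, mul_zero])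
    rw [hr, ← sq, FFHyp.phi_one_of_square hr0]
  have hκneg : (η ^ 6) (-1) = 1 := by
    rw [MulChar.pow_apply' η (by norm_num), show 6 = 2 * 3 from rfl, pow_mul, sq,
      FFHyp.apply_neg_one_sq, one_pow]
  have hcube : ∀ w : Fˣ, (η ^ 8) w = 1 → ∃ u : Fˣ, u ^ 3 = w := by
    intro w hw
    have := FFHyp.exists_pow_eq_of_apply_eq_one hw
    rwa [orderOf_pow, hη] at this
  obtain ⟨ω, hω⟩ := FFHyp.exists_primitive_cube_root (F := F) (by omega)
  have h4 : (4 : F) ≠ 0 := by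
    rw [show (4 : F) = 2 * 2 by norm_num]; exact mul_ne_zero h2 h2
  have h8 : (8 : F) ≠ 0 := by
    rw [show (8 : F) = 4 * 2 by norm_num]; exact mul_ne_zero h4 h2
  have hd : 1 - 4 * x ≠ 0 := fun h => hx₂ (by
    rw [eq_div_iff h4]; linear_combination -h)
  have hx8 : -8 * x ≠ 1 := fun h => hx₁ (by
    rw [eq_div_iff h8]; linear_combination -h)
  have hJ : jacobiSum (η ^ 7) (η ^ 11) ≠ 0 := by
    obtain ⟨ψ, hψ⟩ := FFHyp.exists_isPrimitive F
    intro h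
    have := FFHyp.card_mul_jacobiSum (A := η ^ 7) (B := η ^ 11)
      (fun h => hne 7 (by norm_num) (by norm_num) h.1) hψ
    rw [h, mul_zero] at this
    have hu : IsUnit (-1 : F) := isUnit_one.neg
    exact mul_ne_zero (mul_ne_zero (MulChar.apply_ne_zero_iff.mpr hu)
      (MulChar.apply_ne_zero_iff.mpr hu)) (mul_ne_zero (mul_ne_zero
      (FFHyp.gaussSum_ne_zero _ hψ) (FFHyp.gaussSum_ne_zero _ hψ))
      (FFHyp.gaussSum_ne_zero _ hψ)) this.symm
  have c1 : (η ^ 7)⁻¹ * η ^ 18 = η ^ 11 := by rw [inv_mul_eq_iff_eq_mul, ← pow_add]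
  have hB : η ^ 3 * η ^ 3 = η ^ 6 := by rw [← pow_add]
  rw [FFHyp.hyp21, mul_comm (η ^ 18), c1, ← FFHyp.sum_dihedral_eq h2 hB hs, one_div,
    inv_mul_eq_iff_eq_mul₀ hJ]
  -- At x = 0 the period is the Jacobi sum itself. Of the roots u = 0, 1 only u = 0 contributes, as
  -- η⁶(0) = 0.
  by_cases hx0 : x = 0
  · subst hx0
    simp only [FFHyp.period21, mul_zero, zero_div, zero_mul, sub_zero, map_one, mul_one, c1]
    rw [← jacobiSum]
    have : ∑ u : F, (if 4 * (u * (1 - u)) = 0 then (η ^ 6) (1 - u) else 0) = 1 := by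
      rw [Finset.sum_eq_single 0]
      · simp
      · intro u _ hu
        split_ifs with h
        · have : 1 - u = 0 := by simpa [h4, hu] using h
          rw [this, MulChar.map_zero]
        · rfl
      · simp
    rw [this, mul_one, mul_one]
  · exact FFHyp.hyp21_eq_sum hη hφ2 hκneg hcube hω h2 h3 hx0 hd hx8
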